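/- Let $e_0,e_1,e_2$ be the standard basis of $\mathbb C^3$. For $q\in\mathbb C$ with $q\neq 0$, $q^2\ne 1$, let $R(z)=R(z,q)\in\mathrm{End}(\mathbb C^3\otimes\mathbb C^3)$, $R(z)(e_k\otimes e_l)=\sum_{i,j}R(z)^{ij}_{kl}\,e_i\otimes e_j$, be the $N=3$ Cremmer–Gervais $R$-matrix: $$R(z,q)^{ij}_{kl}=\begin{cases}\dfrac{qz^{-1}-q^{-1}z}{(q-q^{-1})(z-z^{-1})}, & i=j=k=l,\\[2mm] -\dfrac{q^{\mathrm{sgn}(k-l)}}{q-q^{-1}}, & i=k\neq j=l,\\[2mm] \dfrac{z^{\mathrm{sgn}(l-k)}}{z-z^{-1}}, & l=i\ne k=j,\\[2mm] \mathrm{sgn}(l-k), & \min(k,l)<i<\max(k,l),\ i+j=k+l,\\ 0,&\text{otherwise.}\end{cases}$$ The reflection equation for a $3\times3$ matrix function $K$ is $$R_{12}(z_1/z_2)K_1(z_1)R_{21}(z_1z_2)K_2(z_2)=K_2(z_2)R_{12}(z_1z_2)K_1(z_1)R_{21}(z_1/z_2),$$ with $R_{12}=R$, $R_{21}=PRP$,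 $P(x\otimes y)=y\otimes x$, $K_1=K\otimes\mathrm{Id}$, $K_2=\mathrm{Id}\otimes K$. Let $T e_j=e_{2-j}$ and put $$K_{\mathrm I,0}(z,D_1,D_2,E_1)=E_1^2\begin{pmatrix}D_2^2z^2&D_1D_2(z^4-1)&D_1^2z^2(z^4-1)\\0&D_2^2z^2&D_1D_2(z^4-1)\\0&0&D_2^2z^2\end{pmatrix},$$ $$K_{\mathrm I,1}(z,B_1,B_2,D_1,E_2)=-D_1E_2z^2\begin{pmatrix}B_1&0&0\\0&B_1&B_2(1-z^4)\\0&0&B_1z^4\end{pmatrix},$$ $$K_{\mathrm{II},0}(z,F_1,G_1,G_2,G_3)=-F_1\begin{pmatrix}G_3&0&G_1(1-z^4)\\0&G_3&G_2(1-z^4)\\0&0&G_3z^4\end{pmatrix},$$ $$\begin{aligned}K_{\mathrm I}(z;B,D,E)={}&K_{\mathrm I,0}(z,D_1,D_2,E_1)-z^6\,T K_{\mathrm I,0}(z^{-1},D_2,D_1,E_3)T\\&+K_{\mathrm I,1}(z,B_1,B_2,D_1,E_2)-z^6\,TK_{\mathrm I,1}(z^{-1},B_2,B_1,D_2,E_2)T,\end{aligned}$$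 $$K_{\mathrm{II}}(z;b,F,G)=bz^2\,\mathrm{Id}+K_{\mathrm{II},0}(z,F_1,G_1,G_2,G_3)-z^4\,TK_{\mathrm{II},0}(z^{-1},F_2,G_3,-G_2,G_1)T.$$ Let $\mathcal A_{\mathrm I}$ be the set of all functions $z\mapsto K_{\mathrm I}(z;B,D,E)$, where $B=(B_1,B_2)$, $D=(D_1,D_2)$, $E=(E_1,E_2,E_3)$ run over all homogeneous coordinates of all points of $\mathbb P^1(\mathbb C)\times\mathbb P^1(\mathbb C)\times\mathbb P^2(\mathbb C)$. Let $\mathcal A_{\mathrm{II}}$ be the set of all functions $z\mapsto K_{\mathrm{II}}(z;b,F,G)$, where $b\in\mathbb C$ and $F=(F_1,F_2)$, $G=(G_1,G_2,G_3)$ run over all homogeneous coordinates of all points of $\mathbb P^1(\mathbb C)\times\mathbb P^2(\mathbb C)$. Two matrix functions are regarded as equal if they agree up to an overall meromorphic factor that is not identically zero. **Theorem (Main Result).** Let $U\subseteq\mathbb C$ be a nonempty connected open set (for instance $\mathbb C$ or $\mathbb C^\times$). (1) For every $q\in\mathbb C$ with $q\ne0$ and $q^2\neq1$, the set $\mathcal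 K_q(U)$ of not identically zero meromorphic solutions $K(z)$, $z\in U$, of the reflection equation is, up to an overall factor, exactly $\mathcal A_{\mathrm I}\cup\mathcal A_{\mathrm{II}}$. (2) In particular the solution space does not depend on $q$: $\mathcal K_q(U)=\mathcal K_{q'}(U)$ for all such $q,q'$. (3) Let $V\subseteq\mathbb C$ be a nonempty connected open set and let $K(z,q)$ be a $3\times 3$ matrix of meromorphic functions of $(z,q)\in U\times V$. Then $K$ is not identically zero and satisfies the reflection equation identically in $(z_1,z_2,q)$ if and only if, for all $q\in V$ outside a countable set, $z\mapsto K(z,q)$ belongs, up to an overall factor, to $\mathcal A_{\mathrm I}\cup\mathcal A_{\mathrm{II}}$ (with parameters that may depend on $q$). -/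

import Mathlib

open Filter Topology
open scoped Kronecker Matrix

noncomputable section

namespace CremmerGervais

/-! ### The R-matrix and the reflection equation

Operators on `ℂ³` are matrices indexed by `Fin 3`, operators on `ℂ³ ⊗ ℂ³` are matrices indexed by
`Fin 3 × Fin 3`.  The entry `A i j` is the coefficient of `e_i` in `A e_j`. -/

/-- The sign of `a - b` for indices `a b ∈ {0, 1, 2}`. -/
def sgnSub (a b : Fin 3) : ℤ := Int.sign (((a : ℕ) : ℤ) - ((b : ℕ) : ℤ))

/-- The `N = 3` Cremmer–Gervais R-matrix; the row index is `x = (i, j)` (upper indices), the column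
index is `y = (k, l)` (lower indices). -/
def R (z q : ℂ) : Matrix (Fin 3 × Fin 3) (Fin 3 × Fin 3) ℂ :=
  Matrix.of fun x y =>
    let i := x.1
    let j := x.2
    let k := y.1
    let l := y.2
    if i = j ∧ j = k ∧ k = l then (q * z⁻¹ - q⁻¹ * z) / ((q - q⁻¹) * (z - z⁻¹))
    else if i = k ∧ k ≠ j ∧ j = l then -q ^ sgnSub k l / (q - q⁻¹)
    else if l = i ∧ i ≠ k ∧ k = j then z ^ sgnSub l k / (z - z⁻¹)
    else if min k l < i ∧ i < max k l ∧ (i : ℕ) + (j : ℕ) = (k : ℕ) + (l : ℕ) then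
      ((sgnSub l k : ℤ) : ℂ)
    else 0

/-- `R₂₁ = P R P`, where `P (x ⊗ y) = y ⊗ x`. -/
def R21 (z q : ℂ) : Matrix (Fin 3 × Fin 3) (Fin 3 × Fin 3) ℂ :=
  (R z q).submatrix Prod.swap Prod.swap

/-- The reflection equation at the spectral parameters `z₁`, `z₂`, where `M₁`, `M₂` are the values
`K(z₁)`, `K(z₂)`. -/
def ReflectionEq (q z₁ z₂ : ℂ) (M₁ M₂ : Matrix (Fin 3) (Fin 3) ℂ) : Prop :=
  R (z₁ / z₂) q * (M₁ ⊗ₖ (1 : Matrix (Fin 3) (Fin 3) ℂ)) * R21 (z₁ * z₂) q *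
      ((1 : Matrix (Fin 3) (Fin 3) ℂ) ⊗ₖ M₂) =
    ((1 : Matrix (Fin 3) (Fin 3) ℂ) ⊗ₖ M₂) * R (z₁ * z₂) q *
      (M₁ ⊗ₖ (1 : Matrix (Fin 3) (Fin 3) ℂ)) * R21 (z₁ / z₂) q

/-- The values of `q` at which the R-matrix is defined. -/
def Admissible (q : ℂ) : Prop := q ≠ 0 ∧ q ^ 2 ≠ 1

/-- The pairs `(z₁, z₂)` at which `R (z₁ / z₂)` and `R (z₁ * z₂)` are defined. -/
def RegularPair (z₁ z₂ : ℂ) : Prop :=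
  z₁ ≠ 0 ∧ z₂ ≠ 0 ∧ z₁ ^ 2 ≠ z₂ ^ 2 ∧ z₁ ^ 2 * z₂ ^ 2 ≠ 1

/-! ### Solutions for a fixed value of `q` -/

/-- All entries of the matrix function `K` are analytic at `p`. -/
def EntriesAnalyticAt {X : Type*} [NormedAddCommGroup X] [NormedSpace ℂ X]
    (K : X → Matrix (Fin 3) (Fin 3) ℂ) (p : X) : Prop :=
  ∀ i j, AnalyticAt ℂ (fun x => K x i j) p

/-- A (meromorphic) matrix function is not identically zero on `D`: some entry takes a nonzero
value at a point of `D` where it is analytic. -/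
def NotIdenticallyZero {X : Type*} [NormedAddCommGroup X] [NormedSpace ℂ X]
    (K : X → Matrix (Fin 3) (Fin 3) ℂ) (D : Set X) : Prop :=
  ∃ p ∈ D, ∃ i j, AnalyticAt ℂ (fun x => K x i j) p ∧ K p i j ≠ 0

/-- The meromorphic, not identically zero solutions on `U` of the reflection equation with
parameter `q`.  The equation is an identity between meromorphic functions: it holds at all
`(z₁, z₂)` at which everything in it is defined. -/
def solutionSpace (q : ℂ) (U : Set ℂ) : Set (ℂ → Matrix (Fin 3) (Fin 3) ℂ) :=
  {K | (∀ i j, MeromorphicOn (fun z => K z i j) U) ∧ NotIdenticallyZero K U ∧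
    ∀ z₁ ∈ U, ∀ z₂ ∈ U, RegularPair z₁ z₂ → EntriesAnalyticAt K z₁ → EntriesAnalyticAt K z₂ →
      ReflectionEq q z₁ z₂ (K z₁) (K z₂)}

/-- The matrix functions that agree on `U`, as meromorphic functions and up to an overall
meromorphic factor that is not identically zero, with a member of `S`. -/
def upToFactor (U : Set ℂ) (S : Set (ℂ → Matrix (Fin 3) (Fin 3) ℂ)) :
    Set (ℂ → Matrix (Fin 3) (Fin 3) ℂ) :=
  {K | ∃ A ∈ S, ∃ f : ℂ → ℂ, MeromorphicOn f U ∧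
    (∀ᶠ z in codiscreteWithin U, f z ≠ 0) ∧
    ∀ᶠ z in codiscreteWithin U, K z = f z • A z}

/-! ### Solutions that depend meromorphically on `(z, q)` -/

/-- `f` is meromorphic on `D ⊆ ℂ²`: near every point of `D` it is a quotient of two analytic
functions, the denominator not being identically zero near that point. -/
def MeromorphicOn₂ (f : ℂ × ℂ → ℂ) (D : Set (ℂ × ℂ)) : Prop :=
  ∀ p ∈ D, ∃ g h : ℂ × ℂ → ℂ, AnalyticAt ℂ g p ∧ AnalyticAt ℂ h p ∧
    (¬ ∀ᶠ x in 𝓝 p, h x = 0) ∧ ∀ᶠ x in 𝓝 p, h x ≠ 0 → f x = g x / h x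

/-- The not identically zero matrix functions `K(z, q)`, meromorphic in `(z, q) ∈ U × V`, that
satisfy the reflection equation identically in `(z₁, z₂, q)`. -/
def solutionSpace₂ (U V : Set ℂ) : Set (ℂ × ℂ → Matrix (Fin 3) (Fin 3) ℂ) :=
  {K | (∀ i j, MeromorphicOn₂ (fun x => K x i j) (U ×ˢ V)) ∧ NotIdenticallyZero K (U ×ˢ V) ∧
    ∀ z₁ ∈ U, ∀ z₂ ∈ U, ∀ q ∈ V, Admissible q → RegularPair z₁ z₂ →
      EntriesAnalyticAt K (z₁, q) → EntriesAnalyticAt K (z₂, q) →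
      ReflectionEq q z₁ z₂ (K (z₁, q)) (K (z₂, q))}

/-! ### The two families -/

/-- The matrix `T`, `T e_j = e_{2-j}`. -/
def T : Matrix (Fin 3) (Fin 3) ℂ :=
  !![0, 0, 1;
     0, 1, 0;
     1, 0, 0]

def KI0 (z D₁ D₂ E₁ : ℂ) : Matrix (Fin 3) (Fin 3) ℂ :=
  E₁ ^ 2 • !![D₂ ^ 2 * z ^ 2, D₁ * D₂ * (z ^ 4 - 1), D₁ ^ 2 * z ^ 2 * (z ^ 4 - 1);
              0, D₂ ^ 2 * z ^ 2, D₁ * D₂ * (z ^ 4 - 1);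
              0, 0, D₂ ^ 2 * z ^ 2]

def KI1 (z B₁ B₂ D₁ E₂ : ℂ) : Matrix (Fin 3) (Fin 3) ℂ :=
  (-(D₁ * E₂ * z ^ 2)) • !![B₁, 0, 0;
                            0, B₁, B₂ * (1 - z ^ 4);
                            0, 0, B₁ * z ^ 4]

/-- `K_I(z, (B₁, B₂) × (D₁, D₂) × (E₁, E₂, E₃))`; the coordinates are numbered from `0`. -/
def KI (z : ℂ) (B D : Fin 2 → ℂ) (E : Fin 3 → ℂ) : Matrix (Fin 3) (Fin 3) ℂ :=
  KI0 z (D 0) (D 1) (E 0) - z ^ 6 • (T * KI0 z⁻¹ (D 1) (D 0) (E 2) * T)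
    + KI1 z (B 0) (B 1) (D 0) (E 1) - z ^ 6 • (T * KI1 z⁻¹ (B 1) (B 0) (D 1) (E 1) * T)

def KII0 (z F₁ G₁ G₂ G₃ : ℂ) : Matrix (Fin 3) (Fin 3) ℂ :=
  (-F₁) • !![G₃, 0, G₁ * (1 - z ^ 4);
             0, G₃, G₂ * (1 - z ^ 4);
             0, 0, G₃ * z ^ 4]

/-- `K_II(z, b × (F₁, F₂) × (G₁, G₂, G₃))`; the coordinates are numbered from `0`. -/
def KII (z b : ℂ) (F : Fin 2 → ℂ) (G : Fin 3 → ℂ) : Matrix (Fin 3) (Fin 3) ℂ :=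
  (b * z ^ 2) • (1 : Matrix (Fin 3) (Fin 3) ℂ) + KII0 z (F 0) (G 0) (G 1) (G 2)
    - z ^ 4 • (T * KII0 z⁻¹ (F 1) (G 2) (-G 1) (G 0) * T)

/-- The projective space `ℙⁿ(ℂ)`. -/
abbrev PC (n : ℕ) : Type := Projectivization ℂ (Fin (n + 1) → ℂ)

/-- `v` is a vector of homogeneous coordinates of the point `p` of `ℙⁿ(ℂ)`. -/
def IsCoords {n : ℕ} (v : Fin (n + 1) → ℂ) (p : PC n) : Prop :=
  ∃ hv : v ≠ 0, Projectivization.mk ℂ v hv = p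

/-- The family `𝒜_I`, parametrized by `ℙ¹ × ℙ¹ × ℙ²`.  The formula for `K_I` is not homogeneous in
each factor, so all homogeneous coordinates of a point are admitted. -/
def AI : Set (ℂ → Matrix (Fin 3) (Fin 3) ℂ) :=
  {A | ∃ P : PC 1 × PC 1 × PC 2, ∃ (B D : Fin 2 → ℂ) (E : Fin 3 → ℂ),
    IsCoords B P.1 ∧ IsCoords D P.2.1 ∧ IsCoords E P.2.2 ∧ A = fun z => KI z B D E}

/-- The family `𝒜_II`, parametrized by `ℂ × ℙ¹ × ℙ²`; again all homogeneous coordinates of a point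
are admitted. -/
def AII : Set (ℂ → Matrix (Fin 3) (Fin 3) ℂ) :=
  {A | ∃ P : ℂ × PC 1 × PC 2, ∃ (F : Fin 2 → ℂ) (G : Fin 3 → ℂ),
    IsCoords F P.2.1 ∧ IsCoords G P.2.2 ∧ A = fun z => KII z P.1 F G}

end CremmerGervais

end

/-! After clearing denominators, R depends on `z` only through `z ^ 2` and on `q` only through `s =
1 / (q ^ 2 - 1)`. The reflection equation thus becomes polynomial in `x = z₁ ^ 2`, `y = z₂ ^ 2`, `s`
and the entries of the two matrices. Both families are matrix polynomials in `x`, and they satisfy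
it identically in `s`. This is one inclusion, and it holds for all `q` at once.

For the converse no functional equation has to be solved. Fix a base point `z₀` and put `A = K(z₀)`.
For generic `z` the matrix `B = K(z)` satisfies the equation with `A` in both orders, and a few
scalar entries then determine `B` up to a factor as the value of an explicit polynomial family whose
parameters depend only on `A` and `x = z₀ ^ 2`. Which entries serve depends on the first entry of
`K`, in the order 01, 21, 02, 20, 12, 10, that is not identically zero; if there is none, `K` is
diagonal. Reversing indices while inverting `x`, `y` and `q` is a symmetry, so only 01, 02, 12 and
one diagonal case need computation (`Compatible.eq_polyI_of_entry_01`,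
`Compatible.eq_polyII_of_entry_02`, `Compatible.eq_poly_of_entry_12`, `exists_family_of_diagonal`;
assembled in `exists_family`). The only conditions on `q` used are `s ≠ 0` and `s + 1 ≠ 0`, hence
the independence of `q`.

Analysis enters in two places. On a connected open set a meromorphic function vanishes either almost
everywhere or almost nowhere, so the case distinction is uniform in `z`. For solutions depending on
`q`, all but countably many slices are honest meromorphic solutions, and conversely the equation
extends from the dense set of good `q` by continuity. -/

open Filter Topology
open scoped Kronecker Matrix

namespace CremmerGervais

/-! ### Clearing denominators in the reflection equation -/

/-- The R-matrix with its denominator `a - b` cleared, where `z ^ 2 = a / b` and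
`s = 1 / (q ^ 2 - 1)`. -/
def Rnum (s a b : ℂ) : Matrix (Fin 3 × Fin 3) (Fin 3 × Fin 3) ℂ :=
  Matrix.of fun x y =>
    (if x = y then (if x.1 = x.2 then b - s * (a - b)
      else if x.1 < x.2 then -(s * (a - b)) else -((s + 1) * (a - b))) else 0) +
    (if x = y.swap ∧ x ≠ y then (if y.1 < y.2 then a else b) else 0) +
    (if x = (1, 1) ∧ y = (0, 2) then a - b else 0) -
    (if x = (1, 1) ∧ y = (2, 0) then a - b else 0)

/-- The coefficients `q ^ (±1) / (q - q⁻¹)` are `s + 1` and `s`, and `z ^ (±1) / (z - z⁻¹)` are `a /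
(a - b)` and `b / (a - b)`. Writing `z ^ 2` as a ratio `a / b` treats `z₁ / z₂` and `z₁ * z₂` alike
and keeps everything polynomial. -/
theorem R_eq_smul_Rnum {q z a b : ℂ} (hq : Admissible q) (hz : z ≠ 0) (hb : b ≠ 0) (hab : a ≠ b)
    (h : z ^ 2 * b = a) : R z q = (a - b)⁻¹ • Rnum (q ^ 2 - 1)⁻¹ a b := by
  obtain ⟨hq0, hq1⟩ := hq
  have h1 : q ^ 2 - 1 ≠ 0 := sub_ne_zero.2 hq1
  have h2 : z ^ 2 - 1 ≠ 0 := by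
    intro h0
    exact hab (by linear_combination -h + b * h0)
  have h3 : a - b = b * (z ^ 2 - 1) := by linear_combination -h
  have h4 : q - q⁻¹ = (q ^ 2 - 1) / q := by field_simp
  have h5 : z - z⁻¹ = (z ^ 2 - 1) / z := by field_simp
  have h6 : Int.sign 2 = 1 := rfl
  subst h
  ext ⟨i, j⟩ ⟨k, l⟩
  rw [Matrix.smul_apply, h3]
  simp only [R, Rnum, Matrix.of_apply, h4, h5, h3]
  fin_cases i <;> fin_cases j <;> fin_cases k <;> fin_cases l <;>
    simp [sgnSub, h6] <;> field_simp <;> ring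


/-- The reflection equation with denominators cleared, in the variables `x = z₁ ^ 2`,
`y = z₂ ^ 2`, `s = 1 / (q ^ 2 - 1)`. -/
def ReflectionEqNum (s x y : ℂ) (A B : Matrix (Fin 3) (Fin 3) ℂ) : Prop :=
  Rnum s x y * ((A ⊗ₖ (1 : Matrix (Fin 3) (Fin 3) ℂ)) *
      ((Rnum s (x * y) 1).submatrix Prod.swap Prod.swap *
        ((1 : Matrix (Fin 3) (Fin 3) ℂ) ⊗ₖ B))) =
    ((1 : Matrix (Fin 3) (Fin 3) ℂ) ⊗ₖ B) * (Rnum s (x * y) 1 *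
      ((A ⊗ₖ (1 : Matrix (Fin 3) (Fin 3) ℂ)) * (Rnum s x y).submatrix Prod.swap Prod.swap))

theorem reflectionEq_iff_num {q z₁ z₂ : ℂ} (hq : Admissible q) (hz : RegularPair z₁ z₂)
    (A B : Matrix (Fin 3) (Fin 3) ℂ) :
    ReflectionEq q z₁ z₂ A B ↔
      ReflectionEqNum (q ^ 2 - 1)⁻¹ (z₁ ^ 2) (z₂ ^ 2) A B := by
  obtain ⟨h1, h2, h3, h4⟩ := hz
  have hd : (z₁ ^ 2 - z₂ ^ 2)⁻¹ * (z₁ ^ 2 * z₂ ^ 2 - 1)⁻¹ ≠ 0 :=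
    mul_ne_zero (inv_ne_zero (sub_ne_zero.2 h3)) (inv_ne_zero (sub_ne_zero.2 h4))
  have e1 := R_eq_smul_Rnum hq (div_ne_zero h1 h2) (pow_ne_zero 2 h2) h3
    (by field_simp : (z₁ / z₂) ^ 2 * z₂ ^ 2 = z₁ ^ 2)
  have e2 := R_eq_smul_Rnum hq (mul_ne_zero h1 h2) one_ne_zero h4
    (by ring : (z₁ * z₂) ^ 2 * 1 = z₁ ^ 2 * z₂ ^ 2)
  unfold ReflectionEq ReflectionEqNum R21
  rw [e1, e2]
  simp only [Matrix.submatrix_smul, Pi.smul_apply, Matrix.mul_assoc, Matrix.smul_mul,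
    Matrix.mul_smul, smul_smul]
  rw [mul_comm (z₁ ^ 2 * z₂ ^ 2 - 1)⁻¹]
  exact smul_right_injective _ hd |>.eq_iff

/-! ### Entrywise evaluation of the operator products -/

section RowActions

variable {n : Type*} (M : Matrix (Fin 3 × Fin 3) n ℂ) (A : Matrix (Fin 3) (Fin 3) ℂ)
  (i j : Fin 3) (c : n)

theorem kronecker_one_mul_apply : ((A ⊗ₖ (1 : Matrix (Fin 3) (Fin 3) ℂ)) * M) (i, j) c =
    A i 0 * M (0, j) c + A i 1 * M (1, j) c + A i 2 * M (2, j) c := by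
  rw [Matrix.mul_apply, Fintype.sum_prod_type, Fin.sum_univ_three]
  simp [Matrix.kroneckerMap_apply, Matrix.one_apply]

theorem one_kronecker_mul_apply : (((1 : Matrix (Fin 3) (Fin 3) ℂ) ⊗ₖ A) * M) (i, j) c =
    A j 0 * M (i, 0) c + A j 1 * M (i, 1) c + A j 2 * M (i, 2) c := by
  rw [Matrix.mul_apply, Fintype.sum_prod_type_right, Fin.sum_univ_three]
  simp [Matrix.kroneckerMap_apply, Matrix.one_apply]

theorem Rnum_mul_apply (s a b : ℂ) : (Rnum s a b * M) (i, j) c =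
    (if i = j then (b - s * (a - b)) * M (i, i) c
      else if i < j then -(s * (a - b)) * M (i, j) c + b * M (j, i) c
      else -((s + 1) * (a - b)) * M (i, j) c + a * M (j, i) c) +
    (if i = 1 ∧ j = 1 then (a - b) * (M (0, 2) c - M (2, 0) c) else 0) := by
  rw [Matrix.mul_apply, Fintype.sum_prod_type]
  simp only [Fin.sum_univ_three, Rnum, Matrix.of_apply]
  fin_cases i <;> fin_cases j <;> simp <;> ring

theorem Rnum_submatrix_mul_apply (s a b : ℂ) :
    ((Rnum s a b).submatrix Prod.swap Prod.swap * M) (i, j) c =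
    (if i = j then (b - s * (a - b)) * M (i, i) c
      else if j < i then -(s * (a - b)) * M (i, j) c + b * M (j, i) c
      else -((s + 1) * (a - b)) * M (i, j) c + a * M (j, i) c) +
    (if i = 1 ∧ j = 1 then (a - b) * (M (2, 0) c - M (0, 2) c) else 0) := by
  rw [Matrix.mul_apply, Fintype.sum_prod_type]
  simp only [Fin.sum_univ_three, Rnum, Matrix.of_apply, Matrix.submatrix_apply, Prod.swap]
  fin_cases i <;> fin_cases j <;> simp <;> ring

end RowActions

theorem reflectionEqNum_iff_entries (s x y : ℂ) (A B : Matrix (Fin 3) (Fin 3) ℂ) :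
    ReflectionEqNum s x y A B ↔ ∀ i j k l : Fin 3,
      (Rnum s x y * ((A ⊗ₖ (1 : Matrix (Fin 3) (Fin 3) ℂ)) *
        ((Rnum s (x * y) 1).submatrix Prod.swap Prod.swap *
          ((1 : Matrix (Fin 3) (Fin 3) ℂ) ⊗ₖ B)))) (i, j) (k, l) =
      (((1 : Matrix (Fin 3) (Fin 3) ℂ) ⊗ₖ B) * (Rnum s (x * y) 1 *
        ((A ⊗ₖ (1 : Matrix (Fin 3) (Fin 3) ℂ)) *
          (Rnum s x y).submatrix Prod.swap Prod.swap))) (i, j) (k, l) := by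
  constructor
  · intro h i j k l
    rw [ReflectionEqNum] at h
    rw [h]
  · intro h
    ext ⟨i, j⟩ ⟨k, l⟩
    exact h i j k l

/-! ### The two families and their verification -/

/-- The first family as a matrix polynomial in `x = z ^ 2`. -/
def polyI (x b₁ b₂ d₁ d₂ e₁ e₂ e₃ : ℂ) : Matrix (Fin 3) (Fin 3) ℂ :=
  !![e₁ * d₂ ^ 2 * x - e₃ * d₁ ^ 2 * x ^ 2 + e₂ * (d₂ * b₂ - d₁ * b₁ * x),
      (x ^ 2 - 1) * (e₁ * d₁ * d₂), (x ^ 2 - 1) * (e₁ * d₁ ^ 2 * x);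
    (x ^ 2 - 1) * (d₂ * (e₃ * d₁ * x + e₂ * b₁)),
      e₁ * d₂ ^ 2 * x - e₃ * d₁ ^ 2 * x ^ 2 + e₂ * (d₂ * b₂ * x ^ 2 - d₁ * b₁ * x),
      (x ^ 2 - 1) * (d₁ * (e₁ * d₂ + e₂ * b₂ * x));
    (x ^ 2 - 1) * (e₃ * d₂ ^ 2), (x ^ 2 - 1) * (e₃ * d₁ * d₂ * x),
      e₁ * d₂ ^ 2 * x - e₃ * d₁ ^ 2 * x ^ 2 + e₂ * (d₂ * b₂ * x ^ 2 - d₁ * b₁ * x ^ 3)]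

/-- The second family as a matrix polynomial in `x = z ^ 2`. -/
def polyII (x b f₁ f₂ g₁ g₂ g₃ : ℂ) : Matrix (Fin 3) (Fin 3) ℂ :=
  !![b * x - f₁ * g₃ + f₂ * g₁, 0, (x ^ 2 - 1) * (f₁ * g₁);
    -((x ^ 2 - 1) * (f₂ * g₂)), b * x - f₁ * g₃ + f₂ * g₁ * x ^ 2, (x ^ 2 - 1) * (f₁ * g₂);
    (x ^ 2 - 1) * (f₂ * g₃), 0, b * x + (f₂ * g₁ - f₁ * g₃) * x ^ 2]

theorem T_mul_mul_T (M : Matrix (Fin 3) (Fin 3) ℂ) : T * M * T = M.submatrix Fin.rev Fin.rev := by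
  ext i j
  simp only [T, Matrix.mul_apply, Fin.sum_univ_three, Matrix.submatrix_apply]
  fin_cases i <;> fin_cases j <;> simp

theorem KI_eq_polyI {z : ℂ} (hz : z ≠ 0) (B D : Fin 2 → ℂ) (E : Fin 3 → ℂ) :
    KI z B D E = polyI (z ^ 2) (B 0) (B 1) (D 0) (D 1) (E 0 ^ 2) (E 1) (E 2 ^ 2) := by
  ext i j
  simp only [KI, T_mul_mul_T, KI0, KI1, polyI]
  fin_cases i <;> fin_cases j <;> simp [Fin.rev] <;> field_simp <;> ring

theorem KII_eq_polyII {z : ℂ} (hz : z ≠ 0) (b : ℂ) (F : Fin 2 → ℂ) (G : Fin 3 → ℂ) :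
    KII z b F G = polyII (z ^ 2) b (F 0) (F 1) (G 0) (G 1) (G 2) := by
  ext i j
  simp only [KII, T_mul_mul_T, KII0, polyII]
  fin_cases i <;> fin_cases j <;> simp [Fin.rev] <;> field_simp <;> ring

set_option maxHeartbeats 4000000 in
theorem reflectionEqNum_polyII (s x y b f₁ f₂ g₁ g₂ g₃ : ℂ) :
    ReflectionEqNum s x y (polyII x b f₁ f₂ g₁ g₂ g₃) (polyII y b f₁ f₂ g₁ g₂ g₃) := by
  rw [reflectionEqNum_iff_entries]
  intro i j k l
  simp only [Rnum_mul_apply, Rnum_submatrix_mul_apply, one_kronecker_mul_apply,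
    kronecker_one_mul_apply, Matrix.submatrix_apply, Prod.swap]
  fin_cases i <;> fin_cases j <;> fin_cases k <;> fin_cases l <;>
    simp [Rnum, Matrix.kroneckerMap_apply, polyII] <;> ring

set_option maxHeartbeats 4000000 in
theorem reflectionEqNum_polyI (s x y b₁ b₂ d₁ d₂ e₁ e₂ e₃ : ℂ) :
    ReflectionEqNum s x y (polyI x b₁ b₂ d₁ d₂ e₁ e₂ e₃) (polyI y b₁ b₂ d₁ d₂ e₁ e₂ e₃) := by
  rw [reflectionEqNum_iff_entries]
  intro i j k l
  simp only [Rnum_mul_apply, Rnum_submatrix_mul_apply, one_kronecker_mul_apply,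
    kronecker_one_mul_apply, Matrix.submatrix_apply, Prod.swap]
  fin_cases i <;> fin_cases j <;> fin_cases k <;> fin_cases l <;>
    simp [Rnum, Matrix.kroneckerMap_apply, polyI] <;> ring

/-! ### Symmetries of the equation: rescaling and index reversal -/

theorem ReflectionEqNum.smul {s x y : ℂ} {A B : Matrix (Fin 3) (Fin 3) ℂ}
    (h : ReflectionEqNum s x y A B) (a b : ℂ) : ReflectionEqNum s x y (a • A) (b • B) := by
  unfold ReflectionEqNum at h ⊢
  simp only [Matrix.smul_kronecker, Matrix.kronecker_smul, Matrix.smul_mul, Matrix.mul_smul, h,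
    smul_comm a b]

/-- Replacing `q` by `q⁻¹` sends `s` to `-(s + 1)`; together with `z ↦ z⁻¹` this amounts to
conjugation by `T ⊗ T`. -/
theorem Rnum_inv {s a b : ℂ} (ha : a ≠ 0) (hb : b ≠ 0) : Rnum (-(s + 1)) a⁻¹ b⁻¹ =
    (a * b)⁻¹ • (Rnum s a b).submatrix (Fin.revPerm.prodCongr Fin.revPerm)
      (Fin.revPerm.prodCongr Fin.revPerm) := by
  ext ⟨i, j⟩ ⟨k, l⟩
  simp only [Rnum, Matrix.of_apply, Matrix.smul_apply, Matrix.submatrix_apply,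
    Equiv.prodCongr_apply, Prod.map_apply, Fin.revPerm_apply]
  fin_cases i <;> fin_cases j <;> fin_cases k <;> fin_cases l <;>
    simp [Fin.rev] <;> field_simp <;> ring

theorem ReflectionEqNum.rev {s x y : ℂ} {A B : Matrix (Fin 3) (Fin 3) ℂ} (hx : x ≠ 0) (hy : y ≠ 0)
    (h : ReflectionEqNum s x y A B) : ReflectionEqNum (-(s + 1)) x⁻¹ y⁻¹
      (A.submatrix Fin.rev Fin.rev) (B.submatrix Fin.rev Fin.rev) := by
  have h1 : ∀ M : Matrix (Fin 3) (Fin 3) ℂ, (M.submatrix Fin.rev Fin.rev) ⊗ₖ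
      (1 : Matrix (Fin 3) (Fin 3) ℂ) = (M ⊗ₖ (1 : Matrix (Fin 3) (Fin 3) ℂ)).submatrix
        (Fin.revPerm.prodCongr Fin.revPerm) (Fin.revPerm.prodCongr Fin.revPerm) := by
    intro M
    ext ⟨i, j⟩ ⟨k, l⟩
    simp [Matrix.kroneckerMap_apply, Matrix.one_apply]
  have h2 : ∀ M : Matrix (Fin 3) (Fin 3) ℂ, (1 : Matrix (Fin 3) (Fin 3) ℂ) ⊗ₖ
      (M.submatrix Fin.rev Fin.rev) = ((1 : Matrix (Fin 3) (Fin 3) ℂ) ⊗ₖ M).submatrix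
        (Fin.revPerm.prodCongr Fin.revPerm) (Fin.revPerm.prodCongr Fin.revPerm) := by
    intro M
    ext ⟨i, j⟩ ⟨k, l⟩
    simp [Matrix.kroneckerMap_apply, Matrix.one_apply]
  have h3 : ∀ M : Matrix (Fin 3 × Fin 3) (Fin 3 × Fin 3) ℂ,
      (M.submatrix (Fin.revPerm.prodCongr Fin.revPerm)
        (Fin.revPerm.prodCongr Fin.revPerm)).submatrix Prod.swap Prod.swap =
      (M.submatrix Prod.swap Prod.swap).submatrix (Fin.revPerm.prodCongr Fin.revPerm)
        (Fin.revPerm.prodCongr Fin.revPerm) := fun M => rfl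
  have e1 := Rnum_inv (s := s) hx hy
  have e2 := Rnum_inv (s := s) (mul_ne_zero hx hy) one_ne_zero
  rw [mul_inv, inv_one] at e2
  unfold ReflectionEqNum at h ⊢
  rw [e1, e2, h1, h2]
  simp only [Matrix.submatrix_smul, Pi.smul_apply, h3, Matrix.smul_mul, Matrix.mul_smul,
    Matrix.submatrix_mul_equiv, h, smul_smul]
  rw [mul_comm (x * y)⁻¹]

/-! ### Generic and compatible pairs -/

/-- Generic pairs of (squared) spectral parameters. -/
structure Generic (s x y : ℂ) : Prop where
  s_ne : s ≠ 0
  s_add_one_ne : s + 1 ≠ 0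
  x_ne : x ≠ 0
  y_ne : y ≠ 0
  x_sq_ne : x ^ 2 - 1 ≠ 0
  y_sq_ne : y ^ 2 - 1 ≠ 0
  sub_ne : x - y ≠ 0
  one_sub_mul_ne : 1 - x * y ≠ 0
  -- Up to sign, the last three quantities are the diagonal coefficients `b - s * (a - b)` of `Rnum`
  -- at `(x, y)`, `(y, x)` and `(x * y, 1)`.
  weight_ne : s * x - s * y - y ≠ 0
  weight_ne' : s * y - s * x - x ≠ 0
  weight_mul_ne : 1 + s - s * x * y ≠ 0

theorem Generic.symm {s x y : ℂ} (h : Generic s x y) : Generic s y x where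
  s_ne := h.s_ne
  s_add_one_ne := h.s_add_one_ne
  x_ne := h.y_ne
  y_ne := h.x_ne
  x_sq_ne := h.y_sq_ne
  y_sq_ne := h.x_sq_ne
  sub_ne := fun h0 => h.sub_ne (by linear_combination -h0)
  one_sub_mul_ne := fun h0 => h.one_sub_mul_ne (by linear_combination h0)
  weight_ne := h.weight_ne'
  weight_ne' := h.weight_ne
  weight_mul_ne := fun h0 => h.weight_mul_ne (by linear_combination h0)

theorem Generic.inv {s x y : ℂ} (h : Generic s x y) : Generic (-(s + 1)) x⁻¹ y⁻¹ := by
  have hx := h.x_ne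
  have hy := h.y_ne
  constructor
  · exact neg_ne_zero.2 h.s_add_one_ne
  · exact fun h0 => h.s_ne (by linear_combination -h0)
  · exact inv_ne_zero hx
  · exact inv_ne_zero hy
  · intro h0
    field_simp at h0
    exact h.x_sq_ne (by linear_combination -h0)
  · intro h0
    field_simp at h0
    exact h.y_sq_ne (by linear_combination -h0)
  · intro h0
    field_simp at h0
    exact h.sub_ne (by linear_combination -h0)
  · intro h0
    field_simp at h0
    exact h.one_sub_mul_ne (by linear_combination -h0)
  · intro h0
    field_simp at h0
    exact h.weight_ne (by linear_combination h0)
  · intro h0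
    field_simp at h0
    exact h.weight_ne' (by linear_combination h0)
  · intro h0
    field_simp at h0
    exact h.weight_mul_ne (by linear_combination h0)

/-- `A` at `x` and `B` at `y` satisfy the reflection equation in both orders. -/
structure Compatible (s x y : ℂ) (A B : Matrix (Fin 3) (Fin 3) ℂ) : Prop where
  generic : Generic s x y
  eq : ReflectionEqNum s x y A B
  eq' : ReflectionEqNum s y x B A

theorem Compatible.smul {s x y : ℂ} {A B : Matrix (Fin 3) (Fin 3) ℂ} (h : Compatible s x y A B)
    (a b : ℂ) : Compatible s x y (a • A) (b • B) :=
  ⟨h.generic, h.eq.smul a b, h.eq'.smul b a⟩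

theorem Compatible.symm {s x y : ℂ} {A B : Matrix (Fin 3) (Fin 3) ℂ} (h : Compatible s x y A B) :
    Compatible s y x B A :=
  ⟨h.generic.symm, h.eq', h.eq⟩

theorem Compatible.rev {s x y : ℂ} {A B : Matrix (Fin 3) (Fin 3) ℂ} (h : Compatible s x y A B) :
    Compatible (-(s + 1)) x⁻¹ y⁻¹ (A.submatrix Fin.rev Fin.rev) (B.submatrix Fin.rev Fin.rev) :=
  ⟨h.generic.inv, h.eq.rev h.generic.x_ne h.generic.y_ne,
    h.eq'.rev h.generic.y_ne h.generic.x_ne⟩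

/-! ### The scalar equations used, named by row and column index, with common generic factors
cancelled where possible -/

section Entries

variable {s x y : ℂ} {A B : Matrix (Fin 3) (Fin 3) ℂ}

theorem Compatible.entry_00_00 (h : Compatible s x y A B) :
    (-s * x + s * y + y) * A 0 1 * B 1 0 + (-s * x + s * y + y) * A 0 2 * B 2 0 + (s * x - s * y
      - y) * A 1 0 * B 0 1 + (s * x - s * y - y) * A 2 0 * B 0 2 = 0 := by
  have h1 := (reflectionEqNum_iff_entries s x y A B).1 h.eq 0 0 0 0
  simp only [Rnum_mul_apply, Rnum_submatrix_mul_apply, one_kronecker_mul_apply,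
    kronecker_one_mul_apply, Matrix.submatrix_apply, Prod.swap] at h1
  simp [Rnum, Matrix.kroneckerMap_apply] at h1
  linear_combination h1

theorem Compatible.entry_00_12 (h : Compatible s x y A B) :
    x * A 0 1 * B 0 2 - y * A 0 2 * B 0 1 = 0 := by
  have h1 := (reflectionEqNum_iff_entries s x y A B).1 h.eq 0 0 1 2
  simp only [Rnum_mul_apply, Rnum_submatrix_mul_apply, one_kronecker_mul_apply,
    kronecker_one_mul_apply, Matrix.submatrix_apply, Prod.swap] at h1
  simp [Rnum, Matrix.kroneckerMap_apply] at h1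
  apply mul_left_cancel₀ (mul_ne_zero h.generic.s_ne h.generic.one_sub_mul_ne)
  linear_combination h1

theorem Compatible.entry_00_20 (h : Compatible s x y A B) :
    -x * (1 - x * y) * A 0 0 * B 0 2 - (x - y) * (1 - x * y) * A 0 1 * B 0 1 + x * (1 - y ^ 2) *
      A 0 2 * B 0 0 + (x - y) * A 1 2 * B 0 1 + (x - y) * A 2 2 * B 0 2 = 0 := by
  have h1 := (reflectionEqNum_iff_entries s x y A B).1 h.eq 0 0 2 0
  simp only [Rnum_mul_apply, Rnum_submatrix_mul_apply, one_kronecker_mul_apply,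
    kronecker_one_mul_apply, Matrix.submatrix_apply, Prod.swap] at h1
  simp [Rnum, Matrix.kroneckerMap_apply] at h1
  apply mul_left_cancel₀ h.generic.s_ne
  linear_combination h1

theorem Compatible.entry_01_01 (h : Compatible s x y A B) :
    y * (-1 - s + s * x * y) * A 0 1 * B 1 0 - s * (x - y) * (1 - x * y) * A 0 1 * B 2 1 + y *
      (1 + s - s * x * y) * A 1 0 * B 0 1 + y * A 1 2 * B 2 1 - y * A 2 1 * B 1 2 = 0 := by
  have h1 := (reflectionEqNum_iff_entries s x y A B).1 h.eq 0 1 0 1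
  simp only [Rnum_mul_apply, Rnum_submatrix_mul_apply, one_kronecker_mul_apply,
    kronecker_one_mul_apply, Matrix.submatrix_apply, Prod.swap] at h1
  simp [Rnum, Matrix.kroneckerMap_apply] at h1
  linear_combination h1

theorem Compatible.entry_01_10 (h : Compatible s x y A B) :
    -x * y * (x - y) * A 0 0 * B 0 0 - x * (1 - x * y) * A 0 0 * B 1 1 - (x - y) * A 0 2 * B 2 0
      + y * (1 - x * y) * A 1 1 * B 0 0 + (x - y) * A 1 1 * B 1 1 + (x - y) * A 2 1 * B 1 2 = 0
      := by
  have h1 := (reflectionEqNum_iff_entries s x y A B).1 h.eq 0 1 1 0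
  simp only [Rnum_mul_apply, Rnum_submatrix_mul_apply, one_kronecker_mul_apply,
    kronecker_one_mul_apply, Matrix.submatrix_apply, Prod.swap] at h1
  simp [Rnum, Matrix.kroneckerMap_apply] at h1
  apply mul_left_cancel₀ h.generic.s_ne
  linear_combination h1

theorem Compatible.entry_01_11 (h : Compatible s x y A B) :
    -x * y * (x - y) * A 0 0 * B 0 1 - x * (1 - y ^ 2) * A 0 1 * B 1 1 - (x - y) * A 0 2 * B 2 1
      + y * (1 - x * y) * A 1 1 * B 0 1 = 0 := by
  have h1 := (reflectionEqNum_iff_entries s x y A B).1 h.eq 0 1 1 1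
  simp only [Rnum_mul_apply, Rnum_submatrix_mul_apply, one_kronecker_mul_apply,
    kronecker_one_mul_apply, Matrix.submatrix_apply, Prod.swap] at h1
  simp [Rnum, Matrix.kroneckerMap_apply] at h1
  apply mul_left_cancel₀ h.generic.s_ne
  linear_combination h1

theorem Compatible.entry_01_12 (h : Compatible s x y A B) :
    -x * y * (x - y) * A 0 0 * B 0 2 - x * y * (x - y) * A 0 1 * B 1 2 - y * (1 - x * y) * A 0 2
      * B 1 1 - (x - y) * A 0 2 * B 2 2 + y * (1 - x * y) * A 1 1 * B 0 2 = 0 := by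
  have h1 := (reflectionEqNum_iff_entries s x y A B).1 h.eq 0 1 1 2
  simp only [Rnum_mul_apply, Rnum_submatrix_mul_apply, one_kronecker_mul_apply,
    kronecker_one_mul_apply, Matrix.submatrix_apply, Prod.swap] at h1
  simp [Rnum, Matrix.kroneckerMap_apply] at h1
  apply mul_left_cancel₀ h.generic.s_ne
  linear_combination h1

theorem Compatible.entry_01_20 (h : Compatible s x y A B) :
    -x * (1 - x * y) * A 0 0 * B 1 2 + (x - y) * (1 - x * y) * A 0 1 * B 0 0 - (x - y) * (1 - x
      * y) * A 0 1 * B 1 1 + (x - y) * A 0 2 * B 1 0 + y * (1 - x * y) * A 1 2 * B 0 0 + (x - y)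
      * A 1 2 * B 1 1 + (x - y) * A 2 2 * B 1 2 = 0 := by
  have h1 := (reflectionEqNum_iff_entries s x y A B).1 h.eq 0 1 2 0
  simp only [Rnum_mul_apply, Rnum_submatrix_mul_apply, one_kronecker_mul_apply,
    kronecker_one_mul_apply, Matrix.submatrix_apply, Prod.swap] at h1
  simp [Rnum, Matrix.kroneckerMap_apply] at h1
  apply mul_left_cancel₀ h.generic.s_ne
  linear_combination h1

theorem Compatible.entry_01_21 (h : Compatible s x y A B) :
    (x - y) * A 0 1 * B 0 1 - x * A 0 1 * B 1 2 + y * A 1 2 * B 0 1 = 0 := by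
  have h1 := (reflectionEqNum_iff_entries s x y A B).1 h.eq 0 1 2 1
  simp only [Rnum_mul_apply, Rnum_submatrix_mul_apply, one_kronecker_mul_apply,
    kronecker_one_mul_apply, Matrix.submatrix_apply, Prod.swap] at h1
  simp [Rnum, Matrix.kroneckerMap_apply] at h1
  apply mul_left_cancel₀ (mul_ne_zero h.generic.s_ne h.generic.one_sub_mul_ne)
  linear_combination h1

theorem Compatible.entry_01_22 (h : Compatible s x y A B) :
    (x - y) * A 0 1 * B 0 2 - y * A 0 2 * B 1 2 + y * A 1 2 * B 0 2 = 0 := by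
  have h1 := (reflectionEqNum_iff_entries s x y A B).1 h.eq 0 1 2 2
  simp only [Rnum_mul_apply, Rnum_submatrix_mul_apply, one_kronecker_mul_apply,
    kronecker_one_mul_apply, Matrix.submatrix_apply, Prod.swap] at h1
  simp [Rnum, Matrix.kroneckerMap_apply] at h1
  apply mul_left_cancel₀ (mul_ne_zero h.generic.s_ne h.generic.one_sub_mul_ne)
  linear_combination h1

theorem Compatible.entry_02_11 (h : Compatible s x y A B) :
    -x * A 0 1 * B 2 1 + y * A 2 1 * B 0 1 = 0 := by
  have h1 := (reflectionEqNum_iff_entries s x y A B).1 h.eq 0 2 1 1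
  simp only [Rnum_mul_apply, Rnum_submatrix_mul_apply, one_kronecker_mul_apply,
    kronecker_one_mul_apply, Matrix.submatrix_apply, Prod.swap] at h1
  simp [Rnum, Matrix.kroneckerMap_apply] at h1
  apply mul_left_cancel₀ (mul_ne_zero h.generic.s_ne h.generic.one_sub_mul_ne)
  linear_combination h1

theorem Compatible.entry_02_22 (h : Compatible s x y A B) :
    -x * y * (x - y) * A 0 0 * B 0 2 - x * y * (x - y) * A 0 1 * B 1 2 - x * (1 - y ^ 2) * A 0 2
      * B 2 2 + y * (1 - x * y) * A 2 2 * B 0 2 = 0 := by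
  have h1 := (reflectionEqNum_iff_entries s x y A B).1 h.eq 0 2 2 2
  simp only [Rnum_mul_apply, Rnum_submatrix_mul_apply, one_kronecker_mul_apply,
    kronecker_one_mul_apply, Matrix.submatrix_apply, Prod.swap] at h1
  simp [Rnum, Matrix.kroneckerMap_apply] at h1
  apply mul_left_cancel₀ h.generic.s_ne
  linear_combination h1

theorem Compatible.entry_10_00 (h : Compatible s x y A B) :
    (s + 1) * x * (1 - x * y) * A 0 0 * B 1 0 + x * (1 - x * y) * A 0 1 * B 2 0 - (s + 1) * x *
      (1 - y ^ 2) * A 1 0 * B 0 0 - (s + 1) * (x - y) * A 1 1 * B 1 0 - (s + 1) * (x - y) * A 1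
      2 * B 2 0 + (1 - x * y) * (s * x - s * y - y) * A 2 0 * B 0 1 = 0 := by
  have h1 := (reflectionEqNum_iff_entries s x y A B).1 h.eq 1 0 0 0
  simp only [Rnum_mul_apply, Rnum_submatrix_mul_apply, one_kronecker_mul_apply,
    kronecker_one_mul_apply, Matrix.submatrix_apply, Prod.swap] at h1
  simp [Rnum, Matrix.kroneckerMap_apply] at h1
  linear_combination h1

theorem Compatible.entry_10_02 (h : Compatible s x y A B) :
    -(s + 1) * (x - y) * (1 - x * y) * A 0 0 * B 0 1 + (s + 1) * x * (1 - x * y) * A 0 0 * B 1 2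
      + x * y * (x - y) * A 0 1 * B 0 0 + x * (1 - x * y) * A 0 1 * B 2 2 - (s + 1) * (x - y) *
      A 1 0 * B 0 2 + (x - y) * (1 + s - s * x * y) * A 1 1 * B 0 1 - (s + 1) * (x - y) * A 1 1
      * B 1 2 - (s + 1) * y * (1 - x * y) * A 1 2 * B 0 0 - (s + 1) * (x - y) * A 1 2 * B 2 2 +
      (x - y) * A 2 1 * B 0 2 - y * (1 - x * y) * A 2 2 * B 0 1 = 0 := by
  have h1 := (reflectionEqNum_iff_entries s x y A B).1 h.eq 1 0 0 2
  simp only [Rnum_mul_apply, Rnum_submatrix_mul_apply, one_kronecker_mul_apply,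
    kronecker_one_mul_apply, Matrix.submatrix_apply, Prod.swap] at h1
  simp [Rnum, Matrix.kroneckerMap_apply] at h1
  linear_combination h1

theorem Compatible.entry_10_10 (h : Compatible s x y A B) :
    x * (1 + s - s * x * y) * A 0 1 * B 1 0 + x * A 0 2 * B 2 0 + x * (-1 - s + s * x * y) * A 1
      0 * B 0 1 - x * A 2 0 * B 0 2 + s * (x - y) * (1 - x * y) * A 2 1 * B 0 1 = 0 := by
  have h1 := (reflectionEqNum_iff_entries s x y A B).1 h.eq 1 0 1 0
  simp only [Rnum_mul_apply, Rnum_submatrix_mul_apply, one_kronecker_mul_apply,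
    kronecker_one_mul_apply, Matrix.submatrix_apply, Prod.swap] at h1
  simp [Rnum, Matrix.kroneckerMap_apply] at h1
  linear_combination h1

theorem Compatible.entry_10_20 (h : Compatible s x y A B) :
    x * (1 - x * y) * A 0 0 * B 0 1 - x * (1 - y ^ 2) * A 0 1 * B 0 0 + s * x * (1 - x * y) * A
      0 2 * B 1 0 - s * x * (1 - x * y) * A 1 0 * B 0 2 + (x - y) * (-1 - s + s * x * y) * A 1 1
      * B 0 1 - (x - y) * A 2 1 * B 0 2 + s * (x - y) * (1 - x * y) * A 2 2 * B 0 1 = 0 := by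
  have h1 := (reflectionEqNum_iff_entries s x y A B).1 h.eq 1 0 2 0
  simp only [Rnum_mul_apply, Rnum_submatrix_mul_apply, one_kronecker_mul_apply,
    kronecker_one_mul_apply, Matrix.submatrix_apply, Prod.swap] at h1
  simp [Rnum, Matrix.kroneckerMap_apply] at h1
  linear_combination h1

theorem Compatible.entry_11_02 (h : Compatible s x y A B) :
    -(s + 1) * (x - y) * (1 - x * y) * A 0 0 * B 1 1 + (s + 1) * (x - y) * (1 - x * y) * A 0 0 *
      B 2 2 + x * y * (x - y) * A 0 1 * B 1 0 + (s + 1) * y * (1 - x * y) * A 1 0 * B 1 2 + (x -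
      y) * (1 + s - s * x * y) * A 1 1 * B 1 1 + (1 - x * y) * (-s * x + s * y + y) * A 1 1 * B
      2 2 - (s + 1) * y * (1 - x * y) * A 1 2 * B 1 0 + (x - y) * (-1 - s + s * x * y) * A 2 0 *
      B 0 2 - y * (1 - x * y) * A 2 2 * B 1 1 - (x - y) * A 2 2 * B 2 2 = 0 := by
  have h1 := (reflectionEqNum_iff_entries s x y A B).1 h.eq 1 1 0 2
  simp only [Rnum_mul_apply, Rnum_submatrix_mul_apply, one_kronecker_mul_apply,
    kronecker_one_mul_apply, Matrix.submatrix_apply, Prod.swap] at h1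
  simp [Rnum, Matrix.kroneckerMap_apply] at h1
  linear_combination h1

theorem Compatible.entry_11_21 (h : Compatible s x y A B) :
    x * y * (x - y) * A 0 0 * B 0 1 + x * (1 - y ^ 2) * A 0 1 * B 1 1 + s * x * y * (x - y) * A
      0 2 * B 1 0 + (x - y) * (1 + s - s * x * y) * A 0 2 * B 2 1 + (1 - x * y) * (s * x - s * y
      - y) * A 1 1 * B 0 1 - s * x * (1 - x * y) * A 1 1 * B 1 2 + s * x * (1 - y ^ 2) * A 1 2 *
      B 1 1 - s * (x - y) * (1 - x * y) * A 2 2 * B 0 1 + s * (x - y) * A 2 2 * B 1 2 = 0 := by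
  have h1 := (reflectionEqNum_iff_entries s x y A B).1 h.eq 1 1 2 1
  simp only [Rnum_mul_apply, Rnum_submatrix_mul_apply, one_kronecker_mul_apply,
    kronecker_one_mul_apply, Matrix.submatrix_apply, Prod.swap] at h1
  simp [Rnum, Matrix.kroneckerMap_apply] at h1
  linear_combination h1

theorem Compatible.entry_12_21 (h : Compatible s x y A B) :
    x * (1 - x * y) * A 0 1 * B 2 1 + s * x * y * (x - y) * A 0 2 * B 2 0 - s * x * y * (x - y)
      * A 1 0 * B 0 1 - s * x * y * (x - y) * A 1 1 * B 1 1 - s * x * (1 - x * y) * A 1 1 * B 2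
      2 - y * (1 - x * y) * A 2 1 * B 0 1 + s * y * (1 - x * y) * A 2 2 * B 1 1 + s * (x - y) *
      A 2 2 * B 2 2 = 0 := by
  have h1 := (reflectionEqNum_iff_entries s x y A B).1 h.eq 1 2 2 1
  simp only [Rnum_mul_apply, Rnum_submatrix_mul_apply, one_kronecker_mul_apply,
    kronecker_one_mul_apply, Matrix.submatrix_apply, Prod.swap] at h1
  simp [Rnum, Matrix.kroneckerMap_apply] at h1
  linear_combination h1

theorem Compatible.entry_20_10 (h : Compatible s x y A B) :
    A 0 1 * B 2 0 - A 2 0 * B 0 1 = 0 := by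
  have h1 := (reflectionEqNum_iff_entries s x y A B).1 h.eq 2 0 1 0
  simp only [Rnum_mul_apply, Rnum_submatrix_mul_apply, one_kronecker_mul_apply,
    kronecker_one_mul_apply, Matrix.submatrix_apply, Prod.swap] at h1
  simp [Rnum, Matrix.kroneckerMap_apply] at h1
  apply mul_left_cancel₀ (mul_ne_zero (mul_ne_zero h.generic.s_add_one_ne h.generic.x_ne) h.generic.one_sub_mul_ne)
  linear_combination h1

end Entries

/-! ### Solving for the second matrix, case by case -/

/-- With the 01 entries normalised to 1, the off-diagonal entries of `B` follow one at a time from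
those of `A`. The diagonal is then governed by two constants, and the last equation, read in both
orders, ties these to the off-diagonal data. -/
theorem Compatible.eq_polyI_of_entry_01 {s x y : ℂ} {A B : Matrix (Fin 3) (Fin 3) ℂ}
    (h : Compatible s x y A B) (hA : A 0 1 = 1) (hB : B 0 1 = 1) {α β c τ : ℂ}
    (hα : A 0 2 = α * x) (hβ : A 2 1 = β * x) (hc : A 1 2 = 1 + c * x)
    (hτ : A 1 0 = β * x + τ) :
    α ≠ 0 ∧ (y ^ 2 - 1) • B = polyI y τ (c / α) α 1 (1 / α) 1 (A 2 0) := by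
  have hx := h.generic.x_ne
  have hy := h.generic.y_ne
  have hxy := h.generic.sub_ne
  have h1xy := h.generic.one_sub_mul_ne
  have hx2 := h.generic.x_sq_ne
  have hy2 := h.generic.y_sq_ne
  have b02 : B 0 2 = α * y := by
    have := h.entry_00_12
    rw [hA, hB, hα] at this
    apply mul_left_cancel₀ hx
    linear_combination this
  have b21 : B 2 1 = β * y := by
    have := h.entry_02_11
    rw [hA, hB, hβ] at this
    apply mul_left_cancel₀ hx
    linear_combination -this
  have b20 : B 2 0 = A 2 0 := by
    have := h.entry_20_10
    rw [hA, hB] at this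
    linear_combination this
  have b12 : B 1 2 = 1 + c * y := by
    have := h.entry_01_21
    rw [hA, hB, hc] at this
    apply mul_left_cancel₀ hx
    linear_combination -this
  have b10 : B 1 0 = β * y + τ := by
    have := h.entry_01_01
    rw [hA, hB, hβ, hc, hτ, b21, b12] at this
    apply mul_left_cancel₀ (mul_ne_zero hy h.generic.weight_mul_ne)
    linear_combination -this
  have hβ' : β = α * A 2 0 := by
    have := h.entry_00_00
    rw [hA, hB, hα, hτ, b20, b10, b02] at this
    apply mul_left_cancel₀ (mul_ne_zero hxy h.generic.weight_ne)
    linear_combination this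
  -- The constants are chosen so that `(x ^ 2 - 1) * A 1 1` has the shape `m * x + n * x ^ 2` of the
  -- diagonal of `polyI`; `b11` shows that the same constants serve at `y`.
  obtain ⟨n, hn⟩ : ∃ n, A 0 0 = A 1 1 - n - α * β := ⟨A 1 1 - A 0 0 - α * β, by ring⟩
  obtain ⟨m, hm⟩ : ∃ m, A 1 1 * (x ^ 2 - 1) = m * x + n * x ^ 2 :=
    ⟨(A 1 1 * (x ^ 2 - 1) - n * x ^ 2) / x, by field_simp; ring⟩
  have b11 : B 1 1 * (y ^ 2 - 1) = m * y + n * y ^ 2 := by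
    have := h.entry_01_11
    rw [hA, hB, hα, b21, hn] at this
    apply mul_left_cancel₀ hx
    linear_combination this + y * hm
  have b00 : B 0 0 = B 1 1 - n - α * β := by
    have := h.symm.entry_01_11
    rw [hA, hB, hβ, b02] at this
    apply mul_left_cancel₀ (mul_ne_zero (mul_ne_zero hx hy) hxy)
    linear_combination this - y * hm + x * b11
  have b22 : B 2 2 = B 1 1 - α * τ * y := by
    have := h.symm.entry_10_20
    rw [hA, hB, hα, hτ, b02, b21, b10, b00, hn] at this
    have hs := h.generic.s_ne
    apply mul_left_cancel₀ (mul_ne_zero (mul_ne_zero hs h1xy) hxy)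
    linear_combination -this + y * hm - x * b11
  have a22 : A 2 2 = A 1 1 - α * τ * x := by
    have := h.entry_10_20
    rw [hA, hB, hα, hβ, hτ, b02, b10, b00, hn] at this
    have hs := h.generic.s_ne
    apply mul_left_cancel₀ (mul_ne_zero (mul_ne_zero hs h1xy) hxy)
    linear_combination this + y * hm - x * b11
  -- `k1` and `k2` say that one affine function vanishes at `y` and at `x`. Since `x ≠ y`, both
  -- coefficients vanish, and the constant one gives `α * (m + α * τ) = 1`, so `α ≠ 0`.
  have k1 : α * m + α ^ 2 * τ - 1 + y * (α * (n + α * β) - c) = 0 := by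
    have := h.entry_01_12
    rw [hA, hα, b02, b12, b22, hn] at this
    apply mul_left_cancel₀ (mul_ne_zero (mul_ne_zero hx hy) hxy)
    linear_combination this + α * y ^ 2 * hm - α * x ^ 2 * b11
  have k2 : α * m + α ^ 2 * τ - 1 + x * (α * (n + α * β) - c) = 0 := by
    have := h.symm.entry_01_12
    rw [hB, hα, b02, hc, a22, b00] at this
    apply mul_left_cancel₀ (mul_ne_zero (mul_ne_zero hx hy) hxy)
    linear_combination -this + α * y ^ 2 * hm - α * x ^ 2 * b11
  have k3 : α * (n + α * β) - c = 0 := by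
    apply mul_left_cancel₀ hxy
    linear_combination k2 - k1
  have k4 : α * (m + α * τ) = 1 := by linear_combination k1 - y * k3
  have hα0 : α ≠ 0 := left_ne_zero_of_mul_eq_one k4
  refine ⟨hα0, ?_⟩
  have hc' : c / α = n + α * β := by
    field_simp
    linear_combination -k3
  have hm' : 1 / α = m + α * τ := by
    field_simp
    linear_combination -k4
  have hmm : (1 / α) * α = 1 := by field_simp
  rw [hc']
  ext i j
  simp only [polyI, Matrix.smul_apply, smul_eq_mul]
  fin_cases i <;> fin_cases j <;>
    simp only [Fin.zero_eta, Fin.mk_one, Fin.reduceFinMk, Matrix.of_apply, Matrix.cons_val',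
      Matrix.cons_val_zero, Matrix.cons_val_one, Matrix.cons_val, Matrix.cons_val_fin_one]
  · rw [b00]
    linear_combination b11 - y * hm' - α * y ^ 2 * hβ'
  · rw [hB]
    linear_combination (1 - y ^ 2) * hmm
  · rw [b02]
    linear_combination (1 - y ^ 2) * α * y * hmm
  · rw [b10]
    linear_combination (y ^ 2 - 1) * y * hβ'
  · linear_combination b11 - y * hm' - α * y ^ 2 * hβ'
  · rw [b12]
    linear_combination (1 - y ^ 2) * hmm + (1 - y ^ 2) * y * k3
  · rw [b20]
    ring
  · rw [b21]
    linear_combination (y ^ 2 - 1) * y * hβ'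
  · rw [b22]
    linear_combination b11 - y * hm' - α * y ^ 2 * hβ'

/-- Once the 01 and 21 entries are absent, the normalised off-diagonal part is constant in the
spectral parameter and so are the differences of diagonal entries. The remaining equations `ht` and
`hw` constrain `A` alone and give its 10 and 20 entries the product form found in the second family.
-/
theorem Compatible.eq_polyII_of_entry_02 {s x y : ℂ} {A B : Matrix (Fin 3) (Fin 3) ℂ}
    (h : Compatible s x y A B) (hA01 : A 0 1 = 0) (hB01 : B 0 1 = 0) (hA21 : A 2 1 = 0)
    (hB21 : B 2 1 = 0) (hA : A 0 2 = 1) (hB : B 0 2 = 1) {β δ e : ℂ}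
    (hδ : A 2 2 = A 0 0 + δ) (he : A 1 1 = A 0 0 + e) (hβ : A 0 0 * (x ^ 2 - 1) = β * x + δ) :
    (y ^ 2 - 1) • B = polyII y β 1 e 1 (A 1 2) (e - δ) := by
  have hx := h.generic.x_ne
  have hy := h.generic.y_ne
  have hxy := h.generic.sub_ne
  have h1xy := h.generic.one_sub_mul_ne
  have hx2 := h.generic.x_sq_ne
  have hy2 := h.generic.y_sq_ne
  have b12 : B 1 2 = A 1 2 := by
    have := h.entry_01_22
    simp only [hA01, hA, hB] at this
    apply mul_left_cancel₀ hy
    linear_combination -this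
  have b10 : B 1 0 = A 1 0 := by
    have := h.entry_10_20
    simp only [hA01, hB01, hA21, hA, hB] at this
    apply mul_left_cancel₀ (mul_ne_zero (mul_ne_zero h.generic.s_ne hx) h1xy)
    linear_combination this
  have b20 : B 2 0 = A 2 0 := by
    have := h.entry_10_10
    simp only [hA01, hB01, hA21, hA, hB] at this
    apply mul_left_cancel₀ hx
    linear_combination this
  have b00 : B 0 0 * (y ^ 2 - 1) = β * y + δ := by
    have := h.entry_00_20
    simp only [hA01, hB01, hA, hB, hδ] at this
    apply mul_left_cancel₀ hx
    linear_combination -this + y * hβ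
  have b22 : B 2 2 * (y ^ 2 - 1) = β * y + δ * y ^ 2 := by
    have := h.entry_02_22
    simp only [hA01, hA, hB, hδ] at this
    apply mul_left_cancel₀ hx
    linear_combination this + y * hβ
  have b22' : B 2 2 = B 0 0 + δ := by
    apply mul_left_cancel₀ hy2
    linear_combination b22 - b00
  have b11 : B 1 1 = B 0 0 + e := by
    have := h.entry_01_12
    simp only [hA01, hA, hB, he, b22'] at this
    apply mul_left_cancel₀ (mul_ne_zero hy h1xy)
    linear_combination -this - y * hβ + x * b00
  have ht : A 1 0 = -(e * A 1 2) := by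
    have := h.entry_01_20
    simp only [hA01, hA, hδ, b12, b10, b11] at this
    apply mul_left_cancel₀ hxy
    linear_combination this - A 1 2 * y * hβ + A 1 2 * x * b00
  have hw : A 2 0 = e * (e - δ) := by
    have := h.entry_01_10
    simp only [hA21, hA, he, b20, b11] at this
    apply mul_left_cancel₀ hxy
    linear_combination -this + e * y * hβ - e * x * b00
  ext i j
  simp only [polyII, Matrix.smul_apply, smul_eq_mul]
  fin_cases i <;> fin_cases j <;>
    simp only [Fin.zero_eta, Fin.mk_one, Fin.reduceFinMk, Matrix.of_apply, Matrix.cons_val',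
      Matrix.cons_val_zero, Matrix.cons_val_one, Matrix.cons_val, Matrix.cons_val_fin_one]
  · linear_combination b00
  · rw [hB01]
    ring
  · rw [hB]
    ring
  · rw [b10, ht]
    ring
  · rw [b11]
    linear_combination b00
  · rw [b12]
    ring
  · rw [b20, hw]
  · rw [hB21]
    ring
  · linear_combination b22

/-- The constraint `ε * (β + ε) = 0` splits this case between the two families: `ε = 0` leads to the
second, while `ε ≠ 0` forces `β = -ε` and `τ = 0` and leads to the first, with `e₁ = e₃ = 0`. -/
theorem Compatible.eq_poly_of_entry_12 {s x y : ℂ} {A B : Matrix (Fin 3) (Fin 3) ℂ}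
    (h : Compatible s x y A B) (hA01 : A 0 1 = 0) (hB01 : B 0 1 = 0) (hA21 : A 2 1 = 0)
    (hB21 : B 2 1 = 0) (hA02 : A 0 2 = 0) (hB02 : B 0 2 = 0) (hA20 : A 2 0 = 0)
    (hB20 : B 2 0 = 0) (hA : A 1 2 = 1) (hB : B 1 2 = 1) {β κ ε τ : ℂ}
    (hκ : A 2 2 = A 1 1 - κ) (hβ : A 1 1 * (x ^ 2 - 1) = β * x - κ)
    (hε : A 0 0 * x = A 1 1 * x + ε) (hτ : A 1 0 * x = τ * x - κ * ε) :
    (ε = 0 → (y ^ 2 - 1) • B = polyII y β 1 (-τ) 0 1 κ) ∧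
      (ε ≠ 0 → (y * (y ^ 2 - 1)) • B = polyI y κ 1 1 (-ε) 0 1 0) := by
  have hx := h.generic.x_ne
  have hy := h.generic.y_ne
  have hxy := h.generic.sub_ne
  have h1xy := h.generic.one_sub_mul_ne
  have hx2 := h.generic.x_sq_ne
  have hy2 := h.generic.y_sq_ne
  have hs := h.generic.s_ne
  have hs1 := h.generic.s_add_one_ne
  -- In this combination of the two equations all terms with `A 0 0` and `B 0 0` cancel, leaving `A
  -- 1 1 - A 2 2 = B 1 1 - B 2 2`.
  have b22 : B 2 2 = B 1 1 - κ := by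
    have h1 := h.entry_01_20
    have h2 := h.entry_10_02
    simp only [hA01, hA02, hA, hB, hκ] at h1
    simp only [hA01, hB01, hB02, hA, hB] at h2
    apply mul_left_cancel₀ (mul_ne_zero hs1 hxy)
    linear_combination -h2 - (s + 1) * h1
  have b11 : B 1 1 * (y ^ 2 - 1) = β * y - κ := by
    have := h.entry_11_21
    simp only [hA01, hB01, hA02, hA, hB, hκ] at this
    apply mul_left_cancel₀ (mul_ne_zero hs hx)
    linear_combination -this + s * y * hβ
  have b00 : B 0 0 * y = B 1 1 * y + ε := by
    have := h.entry_01_20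
    simp only [hA01, hA02, hA, hB, hκ] at this
    apply mul_left_cancel₀ h1xy
    linear_combination this + (1 - x * y) * hε - y * hβ + x * b11
  have hεβ : ε * (β + ε) = 0 := by
    have := h.entry_01_10
    simp only [hA02, hA21] at this
    apply mul_left_cancel₀ hxy
    linear_combination -this - ε * hβ + ε * b11 +
      (-(B 0 0 * y) * (x - y) - (1 - x * y) * B 1 1) * hε +
      (-(A 1 1 * x + ε) * (x - y) + (1 - x * y) * A 1 1) * b00
  have b10 : B 1 0 * y = τ * y - κ * ε := by
    have := h.entry_11_02
    simp only [hA01, hA20, hA, hB, hκ, b22] at this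
    apply mul_left_cancel₀ (mul_ne_zero (mul_ne_zero hx hs1) h1xy)
    linear_combination -x * this + x * κ * (y * hβ - x * b11) -
      κ * (s + 1) * (x - y) * (1 - x * y) * hε + (s + 1) * y * (1 - x * y) * hτ
  -- Again an affine function, `t ↦ (κ * t + ε) * τ`, is shown to vanish at both `y` and `x`, whence
  -- `κ * τ = 0` and `ε * τ = 0`.
  have k1 : (κ * y + ε) * τ = 0 := by
    have h1 := h.entry_10_00
    simp only [hA01, hA20, hB20] at h1
    apply mul_left_cancel₀ (mul_ne_zero hs1 hxy)
    linear_combination -y * h1 + (s + 1) * ((1 - x * y) * (B 1 0 * y) * hε +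
      (A 1 1 * x + ε) * (1 - x * y) * b10 - (B 0 0 * y) * (1 - y ^ 2) * hτ -
      (τ * x - κ * ε) * (1 - y ^ 2) * b00 - (x - y) * A 1 1 * b10 -
      (τ * y - κ * ε) * y * hβ + (τ * x - κ * ε) * y * b11 + (x - y) * y * κ * hεβ)
  have k2 : (κ * x + ε) * τ = 0 := by
    have h1 := h.symm.entry_10_00
    simp only [hB01, hA20, hB20] at h1
    apply mul_left_cancel₀ (mul_ne_zero hs1 hxy)
    linear_combination x * h1 - (s + 1) * ((1 - x * y) * (A 1 0 * x) * b00 +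
      (B 1 1 * y + ε) * (1 - x * y) * hτ - (A 0 0 * x) * (1 - x ^ 2) * b10 -
      (τ * y - κ * ε) * (1 - x ^ 2) * hε - (y - x) * B 1 1 * hτ -
      (τ * x - κ * ε) * x * b11 + (τ * y - κ * ε) * x * hβ + (y - x) * x * κ * hεβ)
  have hκτ : κ * τ = 0 := by
    apply mul_left_cancel₀ hxy
    linear_combination k2 - k1
  have hετ : ε ≠ 0 → τ = 0 := by
    intro hε0
    apply mul_left_cancel₀ hε0
    linear_combination k1 - y * hκτ
  constructor
  · intro h0
    subst h0
    have c00 : B 0 0 = B 1 1 := by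
      apply mul_left_cancel₀ hy
      linear_combination b00
    have c10 : B 1 0 = τ := by
      apply mul_left_cancel₀ hy
      linear_combination b10
    ext i j
    simp only [polyII, Matrix.smul_apply, smul_eq_mul]
    fin_cases i <;> fin_cases j <;>
    simp only [Fin.zero_eta, Fin.mk_one, Fin.reduceFinMk, Matrix.of_apply, Matrix.cons_val',
      Matrix.cons_val_zero, Matrix.cons_val_one, Matrix.cons_val, Matrix.cons_val_fin_one]
    · rw [c00]
      linear_combination b11
    · rw [hB01]
      ring
    · rw [hB02]
      ring
    · rw [c10]
      ring
    · linear_combination b11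
    · rw [hB]
      ring
    · rw [hB20]
      linear_combination (y ^ 2 - 1) * hκτ
    · rw [hB21]
      ring
    · rw [b22]
      linear_combination b11
  · intro hε0
    have hτ0 := hετ hε0
    subst hτ0
    have hβ' : β = -ε := by
      have := (mul_eq_zero.1 hεβ).resolve_left hε0
      linear_combination this
    subst hβ'
    ext i j
    simp only [polyI, Matrix.smul_apply, smul_eq_mul]
    fin_cases i <;> fin_cases j <;>
    simp only [Fin.zero_eta, Fin.mk_one, Fin.reduceFinMk, Matrix.of_apply, Matrix.cons_val',
      Matrix.cons_val_zero, Matrix.cons_val_one, Matrix.cons_val, Matrix.cons_val_fin_one]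
    · linear_combination (y ^ 2 - 1) * b00 + y * b11
    · rw [hB01]
      ring
    · rw [hB02]
      ring
    · linear_combination (y ^ 2 - 1) * b10
    · linear_combination y * b11
    · rw [hB]
      ring
    · rw [hB20]
      ring
    · rw [hB21]
      ring
    · rw [b22]
      linear_combination y * b11

/-- Eliminating between two entries leaves this product times `s * (s + 1) * (x - y) * (1 - x * y)`.
It excludes diagonal solutions in which the middle entry differs from both others. -/
theorem Compatible.diagonal_mul_eq_zero {s x y : ℂ} {A B : Matrix (Fin 3) (Fin 3) ℂ}
    (h : Compatible s x y A B) (hA : ∀ i j, i ≠ j → A i j = 0) :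
    (A 0 0 - A 1 1) * (B 1 1 - B 2 2) = 0 := by
  have h1 := h.entry_11_02
  have h2 := h.entry_12_21
  simp only [hA 0 1 (by decide), hA 1 0 (by decide), hA 1 2 (by decide), hA 2 0 (by decide)] at h1
  simp only [hA 0 1 (by decide), hA 0 2 (by decide), hA 1 0 (by decide),
    hA 2 1 (by decide)] at h2
  have hs := h.generic.s_ne
  have hs1 := h.generic.s_add_one_ne
  apply mul_left_cancel₀ (mul_ne_zero (mul_ne_zero hs hs1)
    (mul_ne_zero h.generic.sub_ne h.generic.one_sub_mul_ne))
  linear_combination -s * h1 - h2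

theorem Compatible.diagonal_proportional {s x y : ℂ} {A B : Matrix (Fin 3) (Fin 3) ℂ}
    (h : Compatible s x y A B) (hA : ∀ i j, i ≠ j → A i j = 0) :
    B 1 1 * ((A 2 2 - A 1 1 * x ^ 2) * y - x * (A 2 2 - A 1 1) * y ^ 2) =
      B 2 2 * ((A 2 2 - A 1 1 * x ^ 2) * y - x * (A 2 2 - A 1 1)) := by
  have h2 := h.entry_12_21
  simp only [hA 0 1 (by decide), hA 0 2 (by decide), hA 1 0 (by decide),
    hA 2 1 (by decide)] at h2
  apply mul_left_cancel₀ h.generic.s_ne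
  linear_combination h2

/-! ### From one base value to a whole family member -/

/-- The matrix polynomials in `x = z ^ 2` that represent the members of the two families. -/
def IsFamily (P : ℂ → Matrix (Fin 3) (Fin 3) ℂ) : Prop :=
  (∃ b₁ b₂ d₁ d₂ e₁ e₂ e₃ : ℂ, (d₁ ≠ 0 ∨ d₂ ≠ 0) ∧
    (e₁ ≠ 0 ∨ e₃ ≠ 0 ∨ (e₂ ≠ 0 ∧ (b₁ ≠ 0 ∨ b₂ ≠ 0))) ∧
    P = fun x => polyI x b₁ b₂ d₁ d₂ e₁ e₂ e₃) ∨
  ∃ b f₁ f₂ g₁ g₂ g₃ : ℂ, (f₁ ≠ 0 ∨ f₂ ≠ 0) ∧ (g₁ ≠ 0 ∨ g₂ ≠ 0 ∨ g₃ ≠ 0) ∧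
    P = fun x => polyII x b f₁ f₂ g₁ g₂ g₃

theorem polyI_inv_rev {x : ℂ} (hx : x ≠ 0) (b₁ b₂ d₁ d₂ e₁ e₂ e₃ : ℂ) :
    (polyI x⁻¹ b₁ b₂ d₁ d₂ e₁ e₂ e₃).submatrix Fin.rev Fin.rev =
      (-x⁻¹ ^ 3) • polyI x b₂ b₁ d₂ d₁ e₃ e₂ e₁ := by
  ext i j
  simp only [polyI, Matrix.smul_apply, Matrix.submatrix_apply]
  fin_cases i <;> fin_cases j <;> simp [Fin.rev] <;> field_simp <;> ring_nf

theorem polyII_inv_rev {x : ℂ} (hx : x ≠ 0) (b f₁ f₂ g₁ g₂ g₃ : ℂ) :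
    (polyII x⁻¹ b f₁ f₂ g₁ g₂ g₃).submatrix Fin.rev Fin.rev =
      (-x⁻¹ ^ 2) • polyII x (-b) f₂ f₁ g₃ (-g₂) g₁ := by
  ext i j
  simp only [polyII, Matrix.smul_apply, Matrix.submatrix_apply]
  fin_cases i <;> fin_cases j <;> simp [Fin.rev] <;> field_simp <;> ring_nf

/-- Reversal exchanges the parameters with subscripts 1 and 2 (1 and 3 in the triples), up to signs
and a power of `x`, so each family is stable under the symmetry. -/
theorem IsFamily.exists_rev {P : ℂ → Matrix (Fin 3) (Fin 3) ℂ} (hP : IsFamily P) :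
    ∃ Q, IsFamily Q ∧ ∀ x, x ≠ 0 → ∃ k : ℂ, (P x⁻¹).submatrix Fin.rev Fin.rev = k • Q x := by
  rcases hP with ⟨b₁, b₂, d₁, d₂, e₁, e₂, e₃, hd, he, rfl⟩ | ⟨b, f₁, f₂, g₁, g₂, g₃, hf, hg, rfl⟩
  · refine ⟨_, Or.inl ⟨b₂, b₁, d₂, d₁, e₃, e₂, e₁, hd.symm, by tauto, rfl⟩, fun x hx => ?_⟩
    exact ⟨_, polyI_inv_rev hx b₁ b₂ d₁ d₂ e₁ e₂ e₃⟩
  · refine ⟨_, Or.inr ⟨-b, f₂, f₁, g₃, -g₂, g₁, hf.symm, ?_, rfl⟩, fun x hx => ?_⟩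
    · rw [neg_ne_zero]
      tauto
    · exact ⟨_, polyII_inv_rev hx b f₁ f₂ g₁ g₂ g₃⟩

/-- These parameters give `x` times the identity: the scalar solutions, and a placeholder when there
is nothing to match. -/
theorem isFamily_scalar : IsFamily fun x => polyI x 0 0 0 1 1 0 0 :=
  Or.inl ⟨0, 0, 0, 1, 1, 0, 0, by simp, by simp, rfl⟩

theorem exists_eq_smul_of_smul_inv_smul {k b : ℂ} (hk : k ≠ 0) (hb : b ≠ 0)
    {M N : Matrix (Fin 3) (Fin 3) ℂ} (h : k • b⁻¹ • M = N) : ∃ c : ℂ, M = c • N :=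
  ⟨b * k⁻¹, by rw [← h, smul_smul, smul_smul]; field_simp; simp⟩

section

variable {s x : ℂ} {A : Matrix (Fin 3) (Fin 3) ℂ}

/-- Halves the case analysis: a result for the reversed base matrix at `x⁻¹` and parameter `-(s +
1)` is carried back by the symmetry. The predicate `C` records which entries of `B` vanish. -/
theorem exists_family_of_rev (C : Matrix (Fin 3) (Fin 3) ℂ → Prop)
    (H : ∃ P, IsFamily P ∧ ∀ y B, Compatible (-(s + 1)) x⁻¹ y (A.submatrix Fin.rev Fin.rev) B →
      C B → ∃ c : ℂ, B = c • P y) :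
    ∃ P, IsFamily P ∧ ∀ y B, Compatible s x y A B → C (B.submatrix Fin.rev Fin.rev) →
      ∃ c : ℂ, B = c • P y := by
  obtain ⟨P, hP, h⟩ := H
  obtain ⟨Q, hQ, hPQ⟩ := hP.exists_rev
  refine ⟨Q, hQ, fun y B hB hC => ?_⟩
  obtain ⟨c, hc⟩ := h y⁻¹ _ hB.rev hC
  obtain ⟨k, hk⟩ := hPQ y hB.generic.y_ne
  refine ⟨c * k, ?_⟩
  have : B = (B.submatrix Fin.rev Fin.rev).submatrix Fin.rev Fin.rev := by
    ext i j
    simp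
  rw [this, hc, mul_smul, ← hk]
  rfl

/-- The point is the order of quantifiers: the parameters of `P` are computed from `A` and `x` only,
so a single family member works for all `y` and `B`. -/
theorem exists_family_of_entry_01 (hA : A 0 1 ≠ 0) :
    ∃ P, IsFamily P ∧ ∀ y B, Compatible s x y A B → B 0 1 ≠ 0 → ∃ c : ℂ, B = c • P y := by
  -- That `α ≠ 0`, needed for the parameters to be legitimate, is only known once some compatible
  -- `B` exists.
  by_cases hne : ∃ y B, Compatible s x y A B ∧ B 0 1 ≠ 0
  swap
  · exact ⟨_, isFamily_scalar, fun y B h1 h2 => absurd ⟨y, B, h1, h2⟩ hne⟩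
  set A' := (A 0 1)⁻¹ • A with hA'
  obtain ⟨α, hα⟩ : ∃ α, α = A' 0 2 / x := ⟨_, rfl⟩
  obtain ⟨β, hβ⟩ : ∃ β, β = A' 2 1 / x := ⟨_, rfl⟩
  obtain ⟨c, hc⟩ : ∃ c, c = (A' 1 2 - 1) / x := ⟨_, rfl⟩
  obtain ⟨τ, hτ⟩ : ∃ τ, τ = A' 1 0 - β * x := ⟨_, rfl⟩
  have key : ∀ y B, Compatible s x y A B → B 0 1 ≠ 0 →
      α ≠ 0 ∧ (y ^ 2 - 1) • (B 0 1)⁻¹ • B = polyI y τ (c / α) α 1 (1 / α) 1 (A' 2 0) := by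
    intro y B h hB
    have hx := h.generic.x_ne
    refine (h.smul (A 0 1)⁻¹ (B 0 1)⁻¹).eq_polyI_of_entry_01 (β := β) ?_ ?_ ?_ ?_ ?_ ?_
    · simp [hA]
    · simp [hB]
    · rw [hα, div_mul_cancel₀ _ hx]
    · rw [hβ, div_mul_cancel₀ _ hx]
    · rw [hc, div_mul_cancel₀ _ hx]
      ring
    · rw [hτ]
      simp [hA']
  obtain ⟨y₀, B₀, h₀, hB₀⟩ := hne
  have hα0 := (key y₀ B₀ h₀ hB₀).1
  refine ⟨_, Or.inl ⟨τ, c / α, α, 1, 1 / α, 1, A' 2 0, by simp, by simp [hα0], rfl⟩, ?_⟩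
  intro y B h hB
  exact exists_eq_smul_of_smul_inv_smul h.generic.y_sq_ne hB (key y B h hB).2

theorem exists_family_of_entry_02 (hA01 : A 0 1 = 0) (hA21 : A 2 1 = 0) (hA : A 0 2 ≠ 0) :
    ∃ P, IsFamily P ∧ ∀ y B, Compatible s x y A B → (B 0 1 = 0 ∧ B 2 1 = 0 ∧ B 0 2 ≠ 0) →
      ∃ c : ℂ, B = c • P y := by
  set A' := (A 0 2)⁻¹ • A with hA'
  obtain ⟨δ, hδ⟩ : ∃ δ, δ = A' 2 2 - A' 0 0 := ⟨_, rfl⟩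
  obtain ⟨e, he⟩ : ∃ e, e = A' 1 1 - A' 0 0 := ⟨_, rfl⟩
  obtain ⟨β, hβ⟩ : ∃ β, β = (A' 0 0 * (x ^ 2 - 1) - δ) / x := ⟨_, rfl⟩
  refine ⟨_, Or.inr ⟨β, 1, e, 1, A' 1 2, e - δ, by simp, by simp, rfl⟩, ?_⟩
  rintro y B h ⟨hB01, hB21, hB⟩
  have hx := h.generic.x_ne
  refine exists_eq_smul_of_smul_inv_smul h.generic.y_sq_ne hB ?_
  refine (h.smul (A 0 2)⁻¹ (B 0 2)⁻¹).eq_polyII_of_entry_02 ?_ ?_ ?_ ?_ ?_ ?_ ?_ ?_ ?_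
  · simp [hA01]
  · simp [hB01]
  · simp [hA21]
  · simp [hB21]
  · simp [hA]
  · simp [hB]
  · rw [hδ]
    ring
  · rw [he]
    ring
  · rw [hβ]
    field_simp
    simp only [hA']
    ring

theorem exists_family_of_entry_12 (hA01 : A 0 1 = 0) (hA21 : A 2 1 = 0) (hA02 : A 0 2 = 0)
    (hA20 : A 2 0 = 0) (hA : A 1 2 ≠ 0) :
    ∃ P, IsFamily P ∧ ∀ y B, Compatible s x y A B →
      (B 0 1 = 0 ∧ B 2 1 = 0 ∧ B 0 2 = 0 ∧ B 2 0 = 0 ∧ B 1 2 ≠ 0) → ∃ c : ℂ, B = c • P y := by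
  set A' := (A 1 2)⁻¹ • A with hA'
  obtain ⟨κ, hκ⟩ : ∃ κ, κ = A' 1 1 - A' 2 2 := ⟨_, rfl⟩
  obtain ⟨ε, hε⟩ : ∃ ε, ε = (A' 0 0 - A' 1 1) * x := ⟨_, rfl⟩
  obtain ⟨β, hβ⟩ : ∃ β, β = (A' 1 1 * (x ^ 2 - 1) + κ) / x := ⟨_, rfl⟩
  obtain ⟨τ, hτ⟩ : ∃ τ, τ = A' 1 0 + κ * ε / x := ⟨_, rfl⟩
  have key : ∀ y B, Compatible s x y A B →
      (B 0 1 = 0 ∧ B 2 1 = 0 ∧ B 0 2 = 0 ∧ B 2 0 = 0 ∧ B 1 2 ≠ 0) →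
      (ε = 0 → (y ^ 2 - 1) • (B 1 2)⁻¹ • B = polyII y β 1 (-τ) 0 1 κ) ∧
      (ε ≠ 0 → (y * (y ^ 2 - 1)) • (B 1 2)⁻¹ • B = polyI y κ 1 1 (-ε) 0 1 0) := by
    rintro y B h ⟨hB01, hB21, hB02, hB20, hB⟩
    have hx := h.generic.x_ne
    refine (h.smul (A 1 2)⁻¹ (B 1 2)⁻¹).eq_poly_of_entry_12 ?_ ?_ ?_ ?_ ?_ ?_ ?_ ?_ ?_ ?_ ?_ ?_ ?_ ?_
    · simp [hA01]
    · simp [hB01]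
    · simp [hA21]
    · simp [hB21]
    · simp [hA02]
    · simp [hB02]
    · simp [hA20]
    · simp [hB20]
    · simp [hA]
    · simp [hB]
    · rw [hκ]
      ring
    · rw [hβ]
      field_simp
      simp only [hA']
      ring
    · rw [hε]
      ring
    · rw [hτ]
      field_simp
      simp only [hA']
      ring
  by_cases hε0 : ε = 0
  · refine ⟨_, Or.inr ⟨β, 1, -τ, 0, 1, κ, by simp, by simp, rfl⟩, fun y B h hB => ?_⟩
    exact exists_eq_smul_of_smul_inv_smul h.generic.y_sq_ne hB.2.2.2.2 ((key y B h hB).1 hε0)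
  · refine ⟨_, Or.inl ⟨κ, 1, 1, -ε, 0, 1, 0, by simp, by simp, rfl⟩, fun y B h hB => ?_⟩
    exact exists_eq_smul_of_smul_inv_smul (mul_ne_zero h.generic.y_ne h.generic.y_sq_ne)
      hB.2.2.2.2 ((key y B h hB).2 hε0)

theorem exists_family_of_diagonal (hA : ∀ i j, i ≠ j → A i j = 0) (hA01 : A 0 0 = A 1 1)
    (hA0 : A ≠ 0) :
    ∃ P, IsFamily P ∧ ∀ y B, Compatible s x y A B →
      ((∀ i j, i ≠ j → B i j = 0) ∧ B 0 0 = B 1 1) → ∃ c : ℂ, B = c • P y := by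
  obtain ⟨b, hb⟩ : ∃ b, b = A 2 2 - A 1 1 * x ^ 2 := ⟨_, rfl⟩
  obtain ⟨d, hd⟩ : ∃ d, d = x * (A 2 2 - A 1 1) := ⟨_, rfl⟩
  have hprop : ∀ y B, Compatible s x y A B →
      B 1 1 * (b * y - d * y ^ 2) = B 2 2 * (b * y - d) := by
    intro y B h
    rw [hb, hd]
    exact h.diagonal_proportional hA
  have hbd : ∀ y B, Compatible s x y A B → d = 0 → b ≠ 0 := by
    intro y B h hd0 hb0
    apply hA0
    have h1 : A 2 2 = A 1 1 := by
      have := (mul_eq_zero.1 (hd.symm.trans hd0)).resolve_left h.generic.x_ne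
      linear_combination this
    have h2 : A 1 1 = 0 := by
      apply mul_left_cancel₀ h.generic.x_sq_ne
      rw [hb0, h1] at hb
      linear_combination hb
    ext i j
    by_cases hij : i = j
    · subst hij
      fin_cases i <;> simp [hA01, h1, h2]
    · simp [hA i j hij]
  by_cases hd0 : d = 0
  · refine ⟨_, isFamily_scalar, fun y B h ⟨hB, hB01⟩ => ⟨B 1 1 / y, ?_⟩⟩
    have hy := h.generic.y_ne
    have h22 : B 2 2 = B 1 1 := by
      have h1 := hprop y B h
      rw [hd0] at h1
      apply mul_left_cancel₀ (mul_ne_zero (hbd y B h hd0) hy)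
      linear_combination -h1
    ext i j
    simp only [polyI, Matrix.smul_apply, smul_eq_mul]
    fin_cases i <;> fin_cases j <;> simp [hB, hB01, h22] <;> field_simp
  -- These parameters give the diagonal matrix with entries `b * y - d`, `b * y - d`, `b * y - d * y
  -- ^ 2`. The first and last do not vanish together, since their difference is `d * (y ^ 2 - 1)`.
  · refine ⟨_, Or.inr ⟨b, 1, 0, 0, 0, d, by simp, by simp [hd0], rfl⟩, fun y B h ⟨hB, hB01⟩ => ?_⟩
    have hy := h.generic.y_ne
    have h1 := hprop y B h
    have key : ∃ c, B 1 1 = c * (b * y - d) ∧ B 2 2 = c * (b * y - d * y ^ 2) := by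
      by_cases h0 : b * y - d = 0
      · have h2 : b * y - d * y ^ 2 ≠ 0 := by
          intro h2
          apply mul_ne_zero hd0 h.generic.y_sq_ne
          linear_combination h0 - h2
        refine ⟨B 2 2 / (b * y - d * y ^ 2), ?_, (div_mul_cancel₀ _ h2).symm⟩
        rw [h0, mul_zero] at h1 ⊢
        exact (mul_eq_zero.1 h1).resolve_right h2
      · refine ⟨B 1 1 / (b * y - d), (div_mul_cancel₀ _ h0).symm, ?_⟩
        field_simp
        linear_combination -h1
    obtain ⟨c, hc1, hc2⟩ := key
    refine ⟨c, ?_⟩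
    ext i j
    simp only [polyII, Matrix.smul_apply, smul_eq_mul]
    fin_cases i <;> fin_cases j <;> simp [hB, hB01, hc1, hc2]
    exact Or.inl (by ring)

end

/-- The hypotheses on `W` make the pattern of vanishing entries and of equal diagonal entries the
same at every point, so the case met at `z₀` is also the case met at `z`. -/
theorem exists_family {s : ℂ} {W : Set ℂ} {K : ℂ → Matrix (Fin 3) (Fin 3) ℂ}
    (hK : ∀ z ∈ W, ∀ w ∈ W, Generic s (z ^ 2) (w ^ 2) →
      ReflectionEqNum s (z ^ 2) (w ^ 2) (K z) (K w))
    (hW : ∃ z ∈ W, ∃ w ∈ W, Generic s (z ^ 2) (w ^ 2))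
    (hent : ∀ i j, (∀ z ∈ W, K z i j = 0) ∨ ∀ z ∈ W, K z i j ≠ 0)
    (hdiag : ∀ i j, (∀ z ∈ W, K z i i = K z j j) ∨ ∀ z ∈ W, K z i i ≠ K z j j)
    (hne : ∃ z ∈ W, K z ≠ 0) :
    ∃ P, IsFamily P ∧ ∃ z₀ ∈ W, ∀ z ∈ W, Generic s (z₀ ^ 2) (z ^ 2) →
      ∃ c : ℂ, K z = c • P (z ^ 2) := by
  obtain ⟨z₀, hz₀, hz₀ne⟩ := hne
  obtain ⟨z₁, hz₁, w₁, hw₁, hgen⟩ := hW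
  have hC : ∀ z ∈ W, ∀ w ∈ W, Generic s (z ^ 2) (w ^ 2) →
      Compatible s (z ^ 2) (w ^ 2) (K z) (K w) :=
    fun z hz w hw h => ⟨h, hK z hz w hw h, hK w hw z hz h.symm⟩
  have fin : ∀ C : Matrix (Fin 3) (Fin 3) ℂ → Prop, (∃ P, IsFamily P ∧ ∀ y B,
      Compatible s (z₀ ^ 2) y (K z₀) B → C B → ∃ c : ℂ, B = c • P y) → (∀ z ∈ W, C (K z)) →
      ∃ P, IsFamily P ∧ ∃ z₀ ∈ W, ∀ z ∈ W, Generic s (z₀ ^ 2) (z ^ 2) →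
        ∃ c : ℂ, K z = c • P (z ^ 2) := by
    rintro C ⟨P, hP, h⟩ hCK
    exact ⟨P, hP, z₀, hz₀, fun z hz hg => h _ _ (hC z₀ hz₀ z hz hg) (hCK z hz)⟩
  have r0 : Fin.rev (0 : Fin 3) = 2 := rfl
  have r1 : Fin.rev (1 : Fin 3) = 1 := rfl
  have r2 : Fin.rev (2 : Fin 3) = 0 := rfl
  rcases hent 0 1 with h01 | h01
  swap
  · exact fin _ (exists_family_of_entry_01 (h01 z₀ hz₀)) h01
  rcases hent 2 1 with h21 | h21
  swap
  · exact fin _ (exists_family_of_rev _ (exists_family_of_entry_01 (by simpa [r0, r1] using h21 z₀ hz₀)))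
      (by simpa [r0, r1] using h21)
  rcases hent 0 2 with h02 | h02
  swap
  · exact fin _ (exists_family_of_entry_02 (h01 z₀ hz₀) (h21 z₀ hz₀) (h02 z₀ hz₀))
      fun z hz => ⟨h01 z hz, h21 z hz, h02 z hz⟩
  rcases hent 2 0 with h20 | h20
  swap
  · exact fin _ (exists_family_of_rev _ (exists_family_of_entry_02
      (by simpa [r0, r1] using h21 z₀ hz₀) (by simpa [r2, r1] using h01 z₀ hz₀)
      (by simpa [r0, r2] using h20 z₀ hz₀)))
      fun z hz => by simpa [r0, r1, r2] using ⟨h21 z hz, h01 z hz, h20 z hz⟩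
  rcases hent 1 2 with h12 | h12
  swap
  · exact fin _ (exists_family_of_entry_12 (h01 z₀ hz₀) (h21 z₀ hz₀) (h02 z₀ hz₀) (h20 z₀ hz₀)
      (h12 z₀ hz₀))
      fun z hz => ⟨h01 z hz, h21 z hz, h02 z hz, h20 z hz, h12 z hz⟩
  rcases hent 1 0 with h10 | h10
  swap
  · exact fin _ (exists_family_of_rev _ (exists_family_of_entry_12
      (by simpa [r0, r1] using h21 z₀ hz₀) (by simpa [r2, r1] using h01 z₀ hz₀)
      (by simpa [r0, r2] using h20 z₀ hz₀) (by simpa [r0, r2] using h02 z₀ hz₀)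
      (by simpa [r1, r2] using h10 z₀ hz₀)))
      fun z hz => by
        simpa [r0, r1, r2] using ⟨h21 z hz, h01 z hz, h20 z hz, h02 z hz, h10 z hz⟩
  have hoff : ∀ z ∈ W, ∀ i j, i ≠ j → K z i j = 0 := by
    intro z hz i j hij
    fin_cases i <;> fin_cases j <;>
      first
        | exact absurd rfl hij
        | simp [h01 z hz, h21 z hz, h02 z hz, h20 z hz, h12 z hz, h10 z hz]
  rcases hdiag 0 1 with hd | hd
  · exact fin _ (exists_family_of_diagonal (hoff z₀ hz₀) (hd z₀ hz₀) hz₀ne)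
      fun z hz => ⟨hoff z hz, hd z hz⟩
  rcases hdiag 1 2 with hd' | hd'
  · refine fin _ (exists_family_of_rev _ (exists_family_of_diagonal ?_ ?_ ?_)) ?_
    · intro i j hij
      exact hoff z₀ hz₀ _ _ (fun h => hij (Fin.rev_injective h))
    · simpa [r0, r1] using (hd' z₀ hz₀).symm
    · intro h0
      apply hz₀ne
      ext i j
      simpa using congr_fun (congr_fun h0 i.rev) j.rev
    · intro z hz
      refine ⟨fun i j hij => hoff z hz _ _ (fun h => hij (Fin.rev_injective h)), ?_⟩
      simpa [r0, r1] using (hd' z hz).symm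
  -- Here `K` would be diagonal with its middle entry different from both others everywhere on `W`.
  · exfalso
    have := (hC z₁ hz₁ w₁ hw₁ hgen).diagonal_mul_eq_zero (hoff z₁ hz₁)
    rcases mul_eq_zero.1 this with h | h
    · exact hd z₁ hz₁ (sub_eq_zero.1 h)
    · exact hd' w₁ hw₁ (sub_eq_zero.1 h)

theorem continuous_Rnum {X : Type*} [TopologicalSpace X] {s a b : X → ℂ} (hs : Continuous s)
    (ha : Continuous a) (hb : Continuous b) : Continuous fun t => Rnum (s t) (a t) (b t) := by
  refine continuous_pi fun x => continuous_pi fun y => ?_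
  simp only [Rnum, Matrix.of_apply]
  split_ifs <;> fun_prop

/-- Allows the equation to pass to limits in the spectral parameters, in `q` and in the matrices. -/
theorem isClosed_reflectionEqNum :
    IsClosed {p : ℂ × ℂ × ℂ × Matrix (Fin 3) (Fin 3) ℂ × Matrix (Fin 3) (Fin 3) ℂ |
      ReflectionEqNum p.1 p.2.1 p.2.2.1 p.2.2.2.1 p.2.2.2.2} := by
  have hA : Continuous fun p : ℂ × ℂ × ℂ × Matrix (Fin 3) (Fin 3) ℂ × Matrix (Fin 3) (Fin 3) ℂ =>
      p.2.2.2.1 ⊗ₖ (1 : Matrix (Fin 3) (Fin 3) ℂ) := by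
    refine continuous_pi fun x => continuous_pi fun y => ?_
    simp only [Matrix.kroneckerMap_apply]
    fun_prop
  have hB : Continuous fun p : ℂ × ℂ × ℂ × Matrix (Fin 3) (Fin 3) ℂ × Matrix (Fin 3) (Fin 3) ℂ =>
      (1 : Matrix (Fin 3) (Fin 3) ℂ) ⊗ₖ p.2.2.2.2 := by
    refine continuous_pi fun x => continuous_pi fun y => ?_
    simp only [Matrix.kroneckerMap_apply]
    fun_prop
  have hR1 : Continuous fun p : ℂ × ℂ × ℂ × Matrix (Fin 3) (Fin 3) ℂ ×
      Matrix (Fin 3) (Fin 3) ℂ => Rnum p.1 p.2.1 p.2.2.1 :=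
    continuous_Rnum (by fun_prop) (by fun_prop) (by fun_prop)
  have hR2 : Continuous fun p : ℂ × ℂ × ℂ × Matrix (Fin 3) (Fin 3) ℂ ×
      Matrix (Fin 3) (Fin 3) ℂ => Rnum p.1 (p.2.1 * p.2.2.1) 1 :=
    continuous_Rnum (by fun_prop) (by fun_prop) (by fun_prop)
  exact isClosed_eq
    (hR1.matrix_mul (hA.matrix_mul ((hR2.matrix_submatrix _ _).matrix_mul hB)))
    (hB.matrix_mul (hR2.matrix_mul (hA.matrix_mul (hR1.matrix_submatrix _ _))))

/-! ### The families as matrix polynomials -/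

theorem exists_isFamily_of_mem {A : ℂ → Matrix (Fin 3) (Fin 3) ℂ} (hA : A ∈ AI ∪ AII) :
    ∃ P, IsFamily P ∧ ∀ z, z ≠ 0 → A z = P (z ^ 2) := by
  rcases hA with ⟨P, B, D, E, ⟨hB, -⟩, ⟨hD, -⟩, ⟨hE, -⟩, rfl⟩ | ⟨P, F, G, ⟨hF, -⟩, ⟨hG, -⟩, rfl⟩
  · refine ⟨_, Or.inl ⟨B 0, B 1, D 0, D 1, E 0 ^ 2, E 1, E 2 ^ 2, ?_, ?_, rfl⟩,
      fun z hz => KI_eq_polyI hz B D E⟩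
    · by_contra! h
      exact hD (funext fun i => by fin_cases i <;> simp [h])
    · by_contra! h
      obtain ⟨h0, h2, h1⟩ := h
      by_cases hE1 : E 1 = 0
      · exact hE (funext fun i => by fin_cases i <;> simp_all)
      · exact hB (funext fun i => by fin_cases i <;> simp [h1 hE1])
  · refine ⟨_, Or.inr ⟨P.1, F 0, F 1, G 0, G 1, G 2, ?_, ?_, rfl⟩,
      fun z hz => KII_eq_polyII hz P.1 F G⟩
    · by_contra! h
      exact hF (funext fun i => by fin_cases i <;> simp [h])
    · by_contra! h
      exact hG (funext fun i => by fin_cases i <;> simp [h])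

theorem KI_mem_AI {B D : Fin 2 → ℂ} {E : Fin 3 → ℂ} (hB : B ≠ 0) (hD : D ≠ 0) (hE : E ≠ 0) :
    (fun z => KI z B D E) ∈ AI :=
  ⟨(Projectivization.mk ℂ B hB, Projectivization.mk ℂ D hD, Projectivization.mk ℂ E hE), B, D, E,
    ⟨hB, rfl⟩, ⟨hD, rfl⟩, ⟨hE, rfl⟩, rfl⟩

theorem KII_mem_AII (b : ℂ) {F : Fin 2 → ℂ} {G : Fin 3 → ℂ} (hF : F ≠ 0) (hG : G ≠ 0) :
    (fun z => KII z b F G) ∈ AII :=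
  ⟨(b, Projectivization.mk ℂ F hF, Projectivization.mk ℂ G hG), F, G,
    ⟨hF, rfl⟩, ⟨hG, rfl⟩, rfl⟩

theorem IsFamily.exists_mem {P : ℂ → Matrix (Fin 3) (Fin 3) ℂ} (hP : IsFamily P) :
    ∃ A ∈ AI ∪ AII, ∀ z, z ≠ 0 → A z = P (z ^ 2) := by
  rcases hP with ⟨b₁, b₂, d₁, d₂, e₁, e₂, e₃, hd, he, rfl⟩ | ⟨b, f₁, f₂, g₁, g₂, g₃, hf, hg, rfl⟩
  -- The coordinates `E₁` and `E₃` enter `K_I` only through their squares, so square roots are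
  -- needed to reach arbitrary coefficients.
  · obtain ⟨r₁, rfl⟩ : ∃ r, r ^ 2 = e₁ := IsAlgClosed.exists_pow_nat_eq e₁ two_pos
    obtain ⟨r₃, rfl⟩ : ∃ r, r ^ 2 = e₃ := IsAlgClosed.exists_pow_nat_eq e₃ two_pos
    have hD : (![d₁, d₂] : Fin 2 → ℂ) ≠ 0 := by
      intro h
      have h0 : d₁ = 0 := congr_fun h 0
      have h1 : d₂ = 0 := congr_fun h 1
      simp [h0, h1] at hd
    by_cases hb : b₁ = 0 ∧ b₂ = 0
    -- The zero vector is not a point of the projective line. As `B` enters only through products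
    -- with `E₂`, any point serves for `B` once `E₂` is set to zero.
    · obtain ⟨rfl, rfl⟩ := hb
      refine ⟨_, Or.inl (KI_mem_AI (B := ![1, 0]) (D := ![d₁, d₂]) (E := ![r₁, 0, r₃]) ?_ hD ?_),
        fun z hz => ?_⟩
      · intro h
        exact one_ne_zero (congr_fun h 0)
      · intro h
        have h0 : r₁ = 0 := congr_fun h 0
        have h2 : r₃ = 0 := congr_fun h 2
        simp [h0, h2] at he
      · rw [KI_eq_polyI hz]
        simp [polyI]
    · refine ⟨_, Or.inl (KI_mem_AI (B := ![b₁, b₂]) (D := ![d₁, d₂]) (E := ![r₁, e₂, r₃])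
        ?_ hD ?_), fun z hz => ?_⟩
      · intro h
        exact hb ⟨congr_fun h 0, congr_fun h 1⟩
      · intro h
        have h0 : r₁ = 0 := congr_fun h 0
        have h1 : e₂ = 0 := congr_fun h 1
        have h2 : r₃ = 0 := congr_fun h 2
        simp [h0, h1, h2] at he
      · rw [KI_eq_polyI hz]
        simp
  · refine ⟨_, Or.inr (KII_mem_AII b (F := ![f₁, f₂]) (G := ![g₁, g₂, g₃]) ?_ ?_),
      fun z hz => ?_⟩
    · intro h
      have h0 : f₁ = 0 := congr_fun h 0
      have h1 : f₂ = 0 := congr_fun h 1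
      simp [h0, h1] at hf
    · intro h
      have h0 : g₁ = 0 := congr_fun h 0
      have h1 : g₂ = 0 := congr_fun h 1
      have h2 : g₃ = 0 := congr_fun h 2
      simp [h0, h1, h2] at hg
    · rw [KII_eq_polyII hz]
      simp

theorem IsFamily.reflectionEqNum {P : ℂ → Matrix (Fin 3) (Fin 3) ℂ} (hP : IsFamily P)
    (s x y : ℂ) : ReflectionEqNum s x y (P x) (P y) := by
  rcases hP with ⟨b₁, b₂, d₁, d₂, e₁, e₂, e₃, hd, he, rfl⟩ | ⟨b, f₁, f₂, g₁, g₂, g₃, hf, hg, rfl⟩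
  · exact reflectionEqNum_polyI s x y b₁ b₂ d₁ d₂ e₁ e₂ e₃
  · exact reflectionEqNum_polyII s x y b f₁ f₂ g₁ g₂ g₃

theorem IsFamily.differentiable {P : ℂ → Matrix (Fin 3) (Fin 3) ℂ} (hP : IsFamily P)
    (i j : Fin 3) : Differentiable ℂ fun z => P (z ^ 2) i j := by
  rcases hP with ⟨b₁, b₂, d₁, d₂, e₁, e₂, e₃, hd, he, rfl⟩ | ⟨b, f₁, f₂, g₁, g₂, g₃, hf, hg, rfl⟩
  · fin_cases i <;> fin_cases j <;> simp [polyI] <;> fun_prop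
  · fin_cases i <;> fin_cases j <;> simp [polyII] <;> fun_prop

/-- Were all values zero, those at the sample points 2, 0, 1, -1 would give linear relations that
kill every parameter product, against the nondegeneracy conditions. At 2 the factor `x ^ 2 - 1`
equals 3, which exposes the off-diagonal coefficients. -/
theorem IsFamily.exists_ne_zero {P : ℂ → Matrix (Fin 3) (Fin 3) ℂ} (hP : IsFamily P) :
    ∃ x i j, P x i j ≠ 0 := by
  by_contra! h
  rcases hP with ⟨b₁, b₂, d₁, d₂, e₁, e₂, e₃, hd, he, rfl⟩ | ⟨b, f₁, f₂, g₁, g₂, g₃, hf, hg, rfl⟩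
  · have h1 := h 2 0 2
    have h2 := h 2 2 0
    have h3 := h 2 1 2
    have h4 := h 2 1 0
    have h5 := h 0 0 0
    have h6 := h 1 0 0
    have h7 := h (-1) 0 0
    simp only [polyI, Matrix.of_apply, Matrix.cons_val', Matrix.cons_val_zero,
      Matrix.cons_val_one, Matrix.cons_val, Matrix.cons_val_fin_one] at h1 h2 h3 h4 h5 h6 h7
    by_cases hd1 : d₁ = 0
    · subst hd1
      have hd2 : d₂ ≠ 0 := by simpa using hd
      have he3 : e₃ = 0 := by
        apply mul_left_cancel₀ (pow_ne_zero 2 hd2)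
        linear_combination h2 / 3
      have heb1 : e₂ * b₁ = 0 := by
        apply mul_left_cancel₀ hd2
        linear_combination h4 / 3
      have heb2 : e₂ * b₂ = 0 := by
        apply mul_left_cancel₀ hd2
        linear_combination h5
      have he1 : e₁ = 0 := by
        apply mul_left_cancel₀ (pow_ne_zero 2 hd2)
        linear_combination h6 - d₂ * heb2
      rcases he with he | he | ⟨he, hb | hb⟩
      · exact he he1
      · exact he he3
      · exact mul_ne_zero he hb heb1
      · exact mul_ne_zero he hb heb2
    · have he1 : e₁ = 0 := by
        apply mul_left_cancel₀ (pow_ne_zero 2 hd1)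
        linear_combination h1 / 6
      have heb2 : e₂ * b₂ = 0 := by
        apply mul_left_cancel₀ hd1
        linear_combination h3 / 6 - d₁ * d₂ * he1 / 2
      have he3 : e₃ = 0 := by
        apply mul_left_cancel₀ (pow_ne_zero 2 hd1)
        linear_combination -(h6 + h7) / 2 + d₂ * heb2
      have heb1 : e₂ * b₁ = 0 := by
        apply mul_left_cancel₀ hd1
        linear_combination (h7 - h6) / 2 + d₂ ^ 2 * he1
      rcases he with he | he | ⟨he, hb | hb⟩
      · exact he he1
      · exact he he3
      · exact mul_ne_zero he hb heb1
      · exact mul_ne_zero he hb heb2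
  · have h1 := h 2 0 2
    have h2 := h 2 2 0
    have h3 := h 2 1 2
    have h4 := h 2 1 0
    have h5 := h 0 0 0
    simp only [polyII, Matrix.of_apply, Matrix.cons_val', Matrix.cons_val_zero,
      Matrix.cons_val_one, Matrix.cons_val, Matrix.cons_val_fin_one] at h1 h2 h3 h4 h5
    by_cases hf1 : f₁ = 0
    · subst hf1
      have hf2 : f₂ ≠ 0 := by simpa using hf
      have hg3 : g₃ = 0 := by
        apply mul_left_cancel₀ hf2
        linear_combination h2 / 3
      have hg2 : g₂ = 0 := by
        apply mul_left_cancel₀ hf2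
        linear_combination -h4 / 3
      have hg1 : g₁ = 0 := by
        apply mul_left_cancel₀ hf2
        linear_combination h5
      simp [hg1, hg2, hg3] at hg
    · have hg1 : g₁ = 0 := by
        apply mul_left_cancel₀ hf1
        linear_combination h1 / 3
      have hg2 : g₂ = 0 := by
        apply mul_left_cancel₀ hf1
        linear_combination h3 / 3
      have hg3 : g₃ = 0 := by
        apply mul_left_cancel₀ hf1
        linear_combination -h5 + f₂ * hg1
      simp [hg1, hg2, hg3] at hg

/-! ### Codiscrete sets -/

theorem eventually_codiscreteWithin_iff_of_isOpen {U : Set ℂ} (hU : IsOpen U) {p : ℂ → Prop} :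
    (∀ᶠ z in codiscreteWithin U, p z) ↔ ∀ x ∈ U, ∀ᶠ z in 𝓝[≠] x, p z := by
  rw [Filter.Eventually, mem_codiscreteWithin_iff_forall_mem_nhdsNE]
  refine forall₂_congr fun x hx => ⟨fun h => ?_, fun h => ?_⟩
  · filter_upwards [h, nhdsWithin_le_nhds (hU.mem_nhds hx)] with z hz hzU
    exact hz.resolve_right fun h => h hzU
  · filter_upwards [h] with z hz
    exact Or.inl hz

theorem neBot_codiscreteWithin {U : Set ℂ} (hU : IsOpen U) (hne : U.Nonempty) :
    (codiscreteWithin U).NeBot := by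
  obtain ⟨x, hx⟩ := hne
  rw [neBot_iff]
  intro h
  have h1 : ∀ᶠ z in codiscreteWithin U, False := by
    rw [h]
    exact eventually_bot
  exact (((eventually_codiscreteWithin_iff_of_isOpen hU).1 h1 x hx).exists).elim fun _ h => h

theorem eventually_mem_codiscreteWithin (U : Set ℂ) : ∀ᶠ z in codiscreteWithin U, z ∈ U :=
  self_mem_codiscreteWithin U

theorem eventually_eq_zero_or_eventually_ne_zero {U : Set ℂ} (hUo : IsOpen U)
    (hUc : IsConnected U) {f : ℂ → ℂ} (hf : MeromorphicOn f U) :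
    (∀ᶠ z in codiscreteWithin U, f z = 0) ∨ ∀ᶠ z in codiscreteWithin U, f z ≠ 0 := by
  by_cases h : ∃ u ∈ U, meromorphicOrderAt f u ≠ ⊤
  · exact Or.inr (hf.eventually_codiscreteWithin_apply_ne_zero
      ((hf.exists_meromorphicOrderAt_ne_top_iff_forall_mem hUc).1 h))
  · push Not at h
    refine Or.inl ((eventually_codiscreteWithin_iff_of_isOpen hUo).2 fun x hx => ?_)
    exact meromorphicOrderAt_eq_top_iff.1 (h x hx)

theorem eventually_ne_zero_of_differentiable (U : Set ℂ) {f : ℂ → ℂ} (hf : Differentiable ℂ f)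
    {x : ℂ} (hx : f x ≠ 0) : ∀ᶠ z in codiscreteWithin U, f z ≠ 0 := by
  have h := AnalyticOnNhd.preimage_zero_mem_codiscrete (f := f)
    (fun z _ => hf.analyticAt z) hx
  exact codiscreteWithin_mono (Set.subset_univ U) h

theorem eventually_add_mul_sq_ne_zero (U : Set ℂ) {a b : ℂ} (h : a ≠ 0 ∨ b ≠ 0) :
    ∀ᶠ z in codiscreteWithin U, a + b * z ^ 2 ≠ 0 := by
  have hd : Differentiable ℂ fun z => a + b * z ^ 2 := by fun_prop
  by_cases ha : a = 0
  · have hb : b ≠ 0 := h.resolve_left fun h => h ha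
    exact eventually_ne_zero_of_differentiable U hd (x := 1) (by simpa [ha] using hb)
  · exact eventually_ne_zero_of_differentiable U hd (x := 0) (by simpa using ha)

/-- For fixed `x` each condition on `w` is the nonvanishing of some nonzero `a + b * w ^ 2`, where
`w ^ 4 - 1` is split into two such factors. -/
theorem eventually_generic (U : Set ℂ) {s x : ℂ} (hs : s ≠ 0) (hs1 : s + 1 ≠ 0) (hx : x ≠ 0)
    (hx2 : x ^ 2 - 1 ≠ 0) : ∀ᶠ w in codiscreteWithin U, Generic s x (w ^ 2) := by
  filter_upwards [eventually_add_mul_sq_ne_zero U (a := 0) (b := 1) (by simp),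
    eventually_add_mul_sq_ne_zero U (a := -1) (b := 1) (by simp),
    eventually_add_mul_sq_ne_zero U (a := 1) (b := 1) (by simp),
    eventually_add_mul_sq_ne_zero U (a := x) (b := -1) (by simp),
    eventually_add_mul_sq_ne_zero U (a := 1) (b := -x) (by simp),
    eventually_add_mul_sq_ne_zero U (a := s * x) (b := -(s + 1)) (by simp [hs, hx]),
    eventually_add_mul_sq_ne_zero U (a := -((s + 1) * x)) (b := s) (by simp [hs]),
    eventually_add_mul_sq_ne_zero U (a := 1 + s) (b := -(s * x)) (by simp [hs, hx])]
    with w h1 h2 h3 h4 h5 h6 h7 h8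
  exact
    { s_ne := hs
      s_add_one_ne := hs1
      x_ne := hx
      y_ne := fun h => h1 (by linear_combination h)
      x_sq_ne := hx2
      y_sq_ne := fun h => mul_ne_zero h2 h3 (by linear_combination h)
      sub_ne := fun h => h4 (by linear_combination h)
      one_sub_mul_ne := fun h => h5 (by linear_combination h)
      weight_ne := fun h => h6 (by linear_combination h)
      weight_ne' := fun h => h7 (by linear_combination h)
      weight_mul_ne := fun h => h8 (by linear_combination h) }

theorem Generic.regularPair {s z w : ℂ} (h : Generic s (z ^ 2) (w ^ 2)) : RegularPair z w :=
  ⟨fun h0 => h.x_ne (by rw [h0]; ring), fun h0 => h.y_ne (by rw [h0]; ring),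
    fun h0 => h.sub_ne (sub_eq_zero.2 h0), fun h0 => h.one_sub_mul_ne (by rw [h0]; ring)⟩

/-! ### Solutions for fixed `q` -/

theorem reflectionEqNum_of_tendsto {X : Type*} {l : Filter X} [l.NeBot] {s x y : X → ℂ}
    {A B : X → Matrix (Fin 3) (Fin 3) ℂ} {s₀ x₀ y₀ : ℂ} {A₀ B₀ : Matrix (Fin 3) (Fin 3) ℂ}
    (hs : Tendsto s l (𝓝 s₀)) (hx : Tendsto x l (𝓝 x₀)) (hy : Tendsto y l (𝓝 y₀))
    (hA : Tendsto A l (𝓝 A₀)) (hB : Tendsto B l (𝓝 B₀))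
    (h : ∀ᶠ t in l, ReflectionEqNum (s t) (x t) (y t) (A t) (B t)) :
    ReflectionEqNum s₀ x₀ y₀ A₀ B₀ := by
  have := isClosed_reflectionEqNum.mem_of_tendsto (hs.prodMk_nhds (hx.prodMk_nhds
    (hy.prodMk_nhds (hA.prodMk_nhds hB)))) h
  exact this

-- The equation is assumed only on a codiscrete set `p`, so that the same statement serves for a
-- fixed `q` and for the slices of a solution depending on `q`.
open Classical in
theorem mem_upToFactor_of_reflectionEq {q : ℂ} (hq : Admissible q) {U : Set ℂ} (hUo : IsOpen U)
    (hUc : IsConnected U) {K : ℂ → Matrix (Fin 3) (Fin 3) ℂ}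
    (hK : ∀ i j, MeromorphicOn (fun z => K z i j) U)
    (hne : ∃ i j, ¬ ∀ᶠ z in codiscreteWithin U, K z i j = 0) {p : ℂ → Prop}
    (hp : ∀ᶠ z in codiscreteWithin U, p z)
    (hRE : ∀ z, p z → ∀ w, p w → RegularPair z w → ReflectionEq q z w (K z) (K w)) :
    K ∈ upToFactor U (AI ∪ AII) := by
  have := neBot_codiscreteWithin hUo hUc.nonempty
  have hq2 : q ^ 2 - 1 ≠ 0 := sub_ne_zero.2 hq.2
  obtain ⟨s, hs⟩ : ∃ s, s = (q ^ 2 - 1)⁻¹ := ⟨_, rfl⟩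
  have hs0 : s ≠ 0 := by
    rw [hs]
    exact inv_ne_zero hq2
  have hs1 : s + 1 ≠ 0 := by
    have : s + 1 = q ^ 2 * s := by
      rw [hs]
      field_simp
      ring
    rw [this]
    exact mul_ne_zero (pow_ne_zero 2 hq.1) hs0
  have hent := fun i j => eventually_eq_zero_or_eventually_ne_zero hUo hUc (hK i j)
  have hdiag := fun i j => eventually_eq_zero_or_eventually_ne_zero hUo hUc
    ((hK i i).sub (hK j j))
  -- On this set an entry, or a difference of diagonal entries, vanishes either everywhere or
  -- nowhere, as `exists_family` demands.
  have hgood : ∀ᶠ z in codiscreteWithin U, p z ∧ z ^ 2 ≠ 0 ∧ (z ^ 2) ^ 2 - 1 ≠ 0 ∧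
      (∀ i j, if ∀ᶠ z in codiscreteWithin U, K z i j = 0 then K z i j = 0 else K z i j ≠ 0) ∧
      ∀ i j, if ∀ᶠ z in codiscreteWithin U, K z i i = K z j j then K z i i = K z j j
        else K z i i ≠ K z j j := by
    refine hp.and (((eventually_generic U hs0 hs1 (x := 2) (by norm_num) (by norm_num)).mono
      fun z h => h.y_ne).and (((eventually_generic U hs0 hs1 (x := 2) (by norm_num)
      (by norm_num)).mono fun z h => h.y_sq_ne).and (Eventually.and ?_ ?_)))
    · refine eventually_all.2 fun i => eventually_all.2 fun j => ?_
      split_ifs with h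
      · exact h
      · exact (hent i j).resolve_left h
    · refine eventually_all.2 fun i => eventually_all.2 fun j => ?_
      split_ifs with h
      · exact h
      · refine ((hdiag i j).resolve_left fun h0 => h ?_).mono fun z hz => ?_
        · exact h0.mono fun z hz => sub_eq_zero.1 hz
        · exact sub_ne_zero.1 hz
  obtain ⟨i₀, j₀, hij⟩ := hne
  have hij' := (hent i₀ j₀).resolve_left hij
  obtain ⟨W, hW⟩ : ∃ W : Set ℂ, W = {z | p z ∧ z ^ 2 ≠ 0 ∧ (z ^ 2) ^ 2 - 1 ≠ 0 ∧
      (∀ i j, if ∀ᶠ z in codiscreteWithin U, K z i j = 0 then K z i j = 0 else K z i j ≠ 0) ∧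
      ∀ i j, if ∀ᶠ z in codiscreteWithin U, K z i i = K z j j then K z i i = K z j j
        else K z i i ≠ K z j j} := ⟨_, rfl⟩
  have hWev : ∀ᶠ z in codiscreteWithin U, z ∈ W := by
    rw [hW]
    exact hgood
  obtain ⟨z₁, hz₁⟩ := hWev.exists
  obtain ⟨P, hP, z₀, hz₀, hfam⟩ : ∃ P, IsFamily P ∧ ∃ z₀ ∈ W, ∀ z ∈ W,
      Generic s (z₀ ^ 2) (z ^ 2) → ∃ c : ℂ, K z = c • P (z ^ 2) := by
    apply exists_family
    · intro z hz w hw hg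
      rw [hW] at hz hw
      have := (reflectionEq_iff_num hq hg.regularPair _ _).1 (hRE z hz.1 w hw.1 hg.regularPair)
      rwa [← hs] at this
    · have hz₁' := hz₁
      rw [hW] at hz₁'
      obtain ⟨w, hw, hg⟩ := (hWev.and (eventually_generic U hs0 hs1 hz₁'.2.1 hz₁'.2.2.1)).exists
      exact ⟨z₁, hz₁, w, hw, hg⟩
    · intro i j
      rw [hW]
      by_cases h : ∀ᶠ z in codiscreteWithin U, K z i j = 0
      · exact Or.inl fun z hz => by simpa [h] using hz.2.2.2.1 i j
      · exact Or.inr fun z hz => by simpa [h] using hz.2.2.2.1 i j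
    · intro i j
      rw [hW]
      by_cases h : ∀ᶠ z in codiscreteWithin U, K z i i = K z j j
      · exact Or.inl fun z hz => by simpa [h] using hz.2.2.2.2 i j
      · exact Or.inr fun z hz => by simpa [h] using hz.2.2.2.2 i j
    · obtain ⟨z, hz, hzne⟩ := (hWev.and hij').exists
      exact ⟨z, hz, fun h0 => hzne (by rw [h0]; rfl)⟩
  obtain ⟨A, hA, hAP⟩ := hP.exists_mem
  -- An entry of `P` that is not identically zero serves to read off the scalar factor as a
  -- quotient, which makes it meromorphic.
  obtain ⟨x₀, i, j, hx₀⟩ := hP.exists_ne_zero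
  obtain ⟨r, rfl⟩ : ∃ r, r ^ 2 = x₀ := IsAlgClosed.exists_pow_nat_eq x₀ two_pos
  have hPne := eventually_ne_zero_of_differentiable U (hP.differentiable i j) hx₀
  rw [hW] at hz₀
  have hgen := eventually_generic U hs0 hs1 hz₀.2.1 hz₀.2.2.1
  have hKP : ∀ᶠ z in codiscreteWithin U, K z = (K z i j / P (z ^ 2) i j) • P (z ^ 2) := by
    filter_upwards [hWev, hgen, hPne] with z hzW hzg hzP
    obtain ⟨c, hc⟩ := hfam z hzW hzg
    have : K z i j / P (z ^ 2) i j = c := by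
      rw [hc, Matrix.smul_apply, smul_eq_mul, mul_div_assoc, div_self hzP, mul_one]
    rw [this, hc]
  refine ⟨A, hA, fun z => K z i j / P (z ^ 2) i j, ?_, ?_, ?_⟩
  · exact (hK i j).div fun z _ => ((hP.differentiable i j).analyticAt z).meromorphicAt
  · filter_upwards [hKP, hij'] with z hz hzne h0
    rw [hz, h0] at hzne
    simp at hzne
  · filter_upwards [hKP, hgen] with z hz hzg
    rw [hAP z hzg.regularPair.2.1]
    exact hz

theorem not_eventually_eq_zero_of_notIdenticallyZero {U : Set ℂ} (hUo : IsOpen U)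
    {K : ℂ → Matrix (Fin 3) (Fin 3) ℂ} (h : NotIdenticallyZero K U) :
    ∃ i j, ¬ ∀ᶠ z in codiscreteWithin U, K z i j = 0 := by
  obtain ⟨p, hp, i, j, han, hne⟩ := h
  refine ⟨i, j, fun h0 => ?_⟩
  have h1 := (eventually_codiscreteWithin_iff_of_isOpen hUo).1 h0 p hp
  have h2 : ∀ᶠ z in 𝓝[≠] p, K z i j ≠ 0 :=
    nhdsWithin_le_nhds (han.continuousAt.eventually_ne hne)
  obtain ⟨z, hz, hz'⟩ := (h1.and h2).exists
  exact hz' hz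

theorem EntriesAnalyticAt.tendsto {X : Type*} [NormedAddCommGroup X] [NormedSpace ℂ X]
    {K : X → Matrix (Fin 3) (Fin 3) ℂ} {p : X} (h : EntriesAnalyticAt K p) :
    Tendsto K (𝓝 p) (𝓝 (K p)) :=
  tendsto_pi_nhds.2 fun i => tendsto_pi_nhds.2 fun j => (h i j).continuousAt

theorem eventually_entriesAnalyticAt {U : Set ℂ} {K : ℂ → Matrix (Fin 3) (Fin 3) ℂ}
    (hK : ∀ i j, MeromorphicOn (fun z => K z i j) U) :
    ∀ᶠ z in codiscreteWithin U, EntriesAnalyticAt K z :=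
  eventually_all.2 fun i => eventually_all.2 fun j =>
    (hK i j).eventually_codiscreteWithin_analyticAt

/-- The identity `K = f • P` holds only off a discrete set, whereas the equation is required
wherever `K` is analytic; the exceptional points are reached as limits along punctured
neighbourhoods. -/
theorem upToFactor_subset_solutionSpace {q : ℂ} (hq : Admissible q) {U : Set ℂ} (hUo : IsOpen U)
    (hUc : IsConnected U) : upToFactor U (AI ∪ AII) ⊆ solutionSpace q U := by
  rintro K ⟨A, hA, f, hf, hf0, hKA⟩
  have := neBot_codiscreteWithin hUo hUc.nonempty
  obtain ⟨P, hP, hAP⟩ := exists_isFamily_of_mem hA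
  have hKP : ∀ᶠ z in codiscreteWithin U, K z = f z • P (z ^ 2) := by
    filter_upwards [hKA, compl_singleton_mem_codiscreteWithin (0 : ℂ)] with z hz hz0
    rw [hz, hAP z hz0]
  have hK : ∀ i j, MeromorphicOn (fun z => K z i j) U := by
    intro i j
    have h1 : MeromorphicOn (fun z => f z * P (z ^ 2) i j) U :=
      hf.mul fun z _ => ((hP.differentiable i j).analyticAt z).meromorphicAt
    refine h1.congr_codiscreteWithin ?_ hUo
    filter_upwards [hKP] with z hz
    rw [hz]
    rfl
  refine ⟨hK, ?_, ?_⟩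
  · obtain ⟨x₀, i, j, hx₀⟩ := hP.exists_ne_zero
    obtain ⟨r, rfl⟩ : ∃ r, r ^ 2 = x₀ := IsAlgClosed.exists_pow_nat_eq x₀ two_pos
    obtain ⟨z, ⟨⟨⟨hzP, hzK⟩, hzf⟩, hzU⟩, hza⟩ :=
      ((((eventually_ne_zero_of_differentiable U (hP.differentiable i j) hx₀).and hKP).and
        hf0).and (eventually_mem_codiscreteWithin U)).and (eventually_entriesAnalyticAt hK)
        |>.exists
    refine ⟨z, hzU, i, j, hza i j, ?_⟩
    rw [hzK]
    exact mul_ne_zero hzf hzP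
  · intro z₁ hz₁ z₂ hz₂ hreg h₁ h₂
    rw [reflectionEq_iff_num hq hreg]
    have t₁ : Tendsto (fun t : ℂ × ℂ => t.1) (𝓝[≠] z₁ ×ˢ 𝓝[≠] z₂) (𝓝 z₁) :=
      tendsto_fst.mono_right nhdsWithin_le_nhds
    have t₂ : Tendsto (fun t : ℂ × ℂ => t.2) (𝓝[≠] z₁ ×ˢ 𝓝[≠] z₂) (𝓝 z₂) :=
      tendsto_snd.mono_right nhdsWithin_le_nhds
    refine reflectionEqNum_of_tendsto tendsto_const_nhds (t₁.pow 2) (t₂.pow 2)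
      (h₁.tendsto.comp t₁) (h₂.tendsto.comp t₂) ?_
    have e₁ := (eventually_codiscreteWithin_iff_of_isOpen hUo).1 hKP z₁ hz₁
    have e₂ := (eventually_codiscreteWithin_iff_of_isOpen hUo).1 hKP z₂ hz₂
    filter_upwards [e₁.prod_inl (𝓝[≠] z₂), e₂.prod_inr (𝓝[≠] z₁)] with t ht₁ ht₂
    simp only [Function.comp_apply]
    rw [ht₁, ht₂]
    exact (hP.reflectionEqNum _ _ _).smul _ _

theorem solutionSpace_eq_upToFactor {q : ℂ} (hq : Admissible q) {U : Set ℂ} (hUo : IsOpen U)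
    (hUc : IsConnected U) : solutionSpace q U = upToFactor U (AI ∪ AII) := by
  refine Set.Subset.antisymm ?_ (upToFactor_subset_solutionSpace hq hUo hUc)
  rintro K ⟨hK, hne, hRE⟩
  exact mem_upToFactor_of_reflectionEq hq hUo hUc hK
    (not_eventually_eq_zero_of_notIdenticallyZero hUo hne)
    ((eventually_mem_codiscreteWithin U).and (eventually_entriesAnalyticAt hK))
    fun z hz w hw hreg => hRE z hz.1 w hw.1 hreg hz.2 hw.2

/-! ### Meromorphic functions of two variables -/

theorem countable_diff_of_mem_codiscreteWithin {D s : Set ℂ} (h : s ∈ codiscreteWithin D) :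
    (D \ s).Countable := by
  -- Each set of this cover contains at most one point of `D` outside `s`, so a countable subcover
  -- (Lindelöf) leaves countably many.
  have h1 := TopologicalSpace.countable_cover_nhdsWithin (s := D) (f := fun x => s ∪ Dᶜ ∪ {x})
    fun x hx => by
      have h2 := mem_codiscreteWithin_iff_forall_mem_nhdsNE.1 h x hx
      refine mem_nhdsWithin_of_mem_nhds ?_
      rw [← nhdsNE_sup_pure]
      exact ⟨mem_of_superset h2 Set.subset_union_left, by simp⟩
  obtain ⟨t, -, htc, hcov⟩ := h1
  refine htc.mono fun x hx => ?_
  obtain ⟨y, hy, hxy⟩ := Set.mem_iUnion₂.1 (hcov hx.1)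
  rcases hxy with (h | h) | h
  · exact absurd h hx.2
  · exact absurd hx.1 h
  · rwa [Set.mem_singleton_iff.1 h]

theorem AnalyticOnNhd.section_left {B D : Set ℂ} {h : ℂ × ℂ → ℂ}
    (hh : AnalyticOnNhd ℂ h (B ×ˢ D)) {q : ℂ} (hq : q ∈ D) :
    AnalyticOnNhd ℂ (fun z => h (z, q)) B := fun z hz =>
  (hh (z, q) ⟨hz, hq⟩).comp₂ analyticAt_id analyticAt_const

theorem AnalyticOnNhd.section_right {B D : Set ℂ} {h : ℂ × ℂ → ℂ}
    (hh : AnalyticOnNhd ℂ h (B ×ˢ D)) {z : ℂ} (hz : z ∈ B) :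
    AnalyticOnNhd ℂ (fun q => h (z, q)) D := fun q hq =>
  (hh (z, q) ⟨hz, hq⟩).comp₂ analyticAt_const analyticAt_id

/-- Outside a countable set of parameters, the zeros of an analytic function are isolated. -/
theorem exists_countable_eventually_ne_zero {B D : Set ℂ} (hB : IsPreconnected B)
    (hD : IsPreconnected D) {h : ℂ × ℂ → ℂ} (hh : AnalyticOnNhd ℂ h (B ×ˢ D))
    (hne : ∃ x ∈ B ×ˢ D, h x ≠ 0) :
    ∃ S : Set ℂ, S.Countable ∧ ∀ x ∈ B ×ˢ D, x.2 ∉ S → ∀ᶠ z in 𝓝[≠] x.1, h (z, x.2) ≠ 0 := by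
  obtain ⟨⟨z₁, q₁⟩, ⟨hz₁, hq₁⟩, hx⟩ := hne
  -- Fix `z₁` with `h (z₁, ·)` not identically zero. By the identity theorem a slice that vanishes
  -- near one point vanishes at `z₁`, so every bad parameter is one of the countably many zeros of
  -- `h (z₁, ·)`.
  have h1 := (AnalyticOnNhd.section_right hh hz₁).preimage_zero_mem_codiscreteWithin hx hq₁
    ⟨⟨q₁, hq₁⟩, hD⟩
  refine ⟨_, countable_diff_of_mem_codiscreteWithin h1, fun x hxBD hxS => ?_⟩
  have h2 : h (z₁, x.2) ≠ 0 := by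
    by_contra h0
    exact hxS ⟨hxBD.2, by simp [h0]⟩
  have h3 := AnalyticOnNhd.section_left hh hxBD.2
  rcases (h3 x.1 hxBD.1).eventually_eq_zero_or_eventually_ne_zero with h0 | h0
  · exact absurd (h3.eqOn_zero_of_preconnected_of_eventuallyEq_zero hB hxBD.1 h0 hz₁) h2
  · exact h0

/-- By the Lindelöf property, countably many of the local exceptional sets suffice, and their union
is countable. -/
theorem exists_countable_of_locally {W : Set (ℂ × ℂ)} {Q : ℂ × ℂ → Prop}
    (h : ∀ p ∈ W, ∃ N ∈ 𝓝 p, ∃ S : Set ℂ, S.Countable ∧ ∀ x ∈ N, x.2 ∉ S → Q x) :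
    ∃ S : Set ℂ, S.Countable ∧ ∀ x ∈ W, x.2 ∉ S → Q x := by
  choose! N hN S hS hQ using h
  obtain ⟨t, htW, htc, hcov⟩ := TopologicalSpace.countable_cover_nhdsWithin (s := W) (f := N)
    fun x hx => mem_nhdsWithin_of_mem_nhds (hN x hx)
  refine ⟨⋃ p ∈ t, S p, htc.biUnion fun p hp => hS p (htW hp), fun x hx hxS => ?_⟩
  obtain ⟨p, hp, hxp⟩ := Set.mem_iUnion₂.1 (hcov hx)
  exact hQ p (htW hp) x hxp fun h0 => hxS (Set.mem_iUnion₂.2 ⟨p, hp, h0⟩)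

/-- A meromorphic function is a quotient of analytic functions on a ball. -/
theorem MeromorphicOn₂.exists_ball {f : ℂ × ℂ → ℂ} {W : Set (ℂ × ℂ)} (hf : MeromorphicOn₂ f W)
    {p : ℂ × ℂ} (hp : p ∈ W) : ∃ r > 0, ∃ g h : ℂ × ℂ → ℂ,
      AnalyticOnNhd ℂ g (Metric.ball p r) ∧ AnalyticOnNhd ℂ h (Metric.ball p r) ∧
      (¬ ∀ᶠ x in 𝓝 p, h x = 0) ∧ ∀ x ∈ Metric.ball p r, h x ≠ 0 → f x = g x / h x := by
  obtain ⟨g, h, hg, hh, hne, hfgh⟩ := hf p hp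
  obtain ⟨r, hr, hball⟩ := Metric.eventually_nhds_iff_ball.1
    ((hg.eventually_analyticAt.and hh.eventually_analyticAt).and hfgh)
  exact ⟨r, hr, g, h, fun x hx => (hball x hx).1.1, fun x hx => (hball x hx).1.2, hne,
    fun x hx => (hball x hx).2⟩

theorem exists_countable_eventually_ne_zero_ball {p : ℂ × ℂ} {r : ℝ} (hr : 0 < r)
    {h : ℂ × ℂ → ℂ} (hh : AnalyticOnNhd ℂ h (Metric.ball p r))
    (hne : ¬ ∀ᶠ x in 𝓝 p, h x = 0) :
    ∃ S : Set ℂ, S.Countable ∧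
      ∀ x ∈ Metric.ball p r, x.2 ∉ S → ∀ᶠ z in 𝓝[≠] x.1, h (z, x.2) ≠ 0 := by
  obtain ⟨x, hx, hxb⟩ : ∃ x, h x ≠ 0 ∧ x ∈ Metric.ball p r :=
    ((not_eventually.1 hne).and_eventually (Metric.ball_mem_nhds p hr)).exists
  obtain ⟨z, q⟩ := p
  -- For the sup norm a ball in the product is a product of balls.
  rw [← ball_prod_same] at hh hxb ⊢
  exact exists_countable_eventually_ne_zero (convex_ball _ _).isPreconnected
    (convex_ball _ _).isPreconnected hh ⟨x, hxb, hx⟩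

theorem eventually_slice_mem {x : ℂ × ℂ} {N : Set (ℂ × ℂ)} (hN : N ∈ 𝓝 x) :
    ∀ᶠ z in 𝓝[≠] x.1, (z, x.2) ∈ N := by
  have h : Tendsto (fun z => (z, x.2)) (𝓝 x.1) (𝓝 x) :=
    (continuous_id.prodMk continuous_const).tendsto' _ _ rfl
  exact nhdsWithin_le_nhds (h hN)

theorem analyticAt_of_eq_div {f g h : ℂ × ℂ → ℂ} {N : Set (ℂ × ℂ)} (hN : IsOpen N)
    (hg : AnalyticOnNhd ℂ g N) (hh : AnalyticOnNhd ℂ h N)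
    (hf : ∀ x ∈ N, h x ≠ 0 → f x = g x / h x) {x : ℂ × ℂ} (hx : x ∈ N) (hx0 : h x ≠ 0) :
    AnalyticAt ℂ f x := by
  refine ((hg x hx).div (hh x hx) hx0).congr ?_
  filter_upwards [hN.mem_nhds hx, (hh x hx).continuousAt.eventually_ne hx0] with y hy hy0
  exact (hf y hy hy0).symm

/-- Outside a countable set of parameters, the sections of a meromorphic function are meromorphic
and the function itself is analytic at most points of them. -/
theorem MeromorphicOn₂.exists_countable_section {f : ℂ × ℂ → ℂ} {W : Set (ℂ × ℂ)}
    (hf : MeromorphicOn₂ f W) :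
    ∃ S : Set ℂ, S.Countable ∧ ∀ x ∈ W, x.2 ∉ S →
      MeromorphicAt (fun z => f (z, x.2)) x.1 ∧ ∀ᶠ z in 𝓝[≠] x.1, AnalyticAt ℂ f (z, x.2) := by
  refine exists_countable_of_locally fun p hp => ?_
  obtain ⟨r, hr, g, h, hg, hh, hne, hfgh⟩ := hf.exists_ball hp
  obtain ⟨S, hS, hSh⟩ := exists_countable_eventually_ne_zero_ball hr hh hne
  refine ⟨_, Metric.ball_mem_nhds p hr, S, hS, fun x hx hxS => ?_⟩
  have h1 := hSh x hx hxS
  have h2 := eventually_slice_mem (Metric.isOpen_ball.mem_nhds hx)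
  refine ⟨?_, ?_⟩
  · have hg1 : AnalyticAt ℂ (fun z => g (z, x.2)) x.1 :=
      AnalyticAt.comp₂ (f := id) (g := fun _ => x.2) (hg x hx) analyticAt_id analyticAt_const
    have hh1 : AnalyticAt ℂ (fun z => h (z, x.2)) x.1 :=
      AnalyticAt.comp₂ (f := id) (g := fun _ => x.2) (hh x hx) analyticAt_id analyticAt_const
    refine (hg1.meromorphicAt.div hh1.meromorphicAt).congr ?_
    filter_upwards [h1, h2] with z hz hzb
    exact (hfgh _ hzb hz).symm
  · filter_upwards [h1, h2] with z hz hzb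
    exact analyticAt_of_eq_div Metric.isOpen_ball hg hh hfgh hzb hz

/-- A meromorphic function on a connected set that vanishes on no neighbourhood of some point
vanishes on no open set. -/
theorem MeromorphicOn₂.notMem_closure_interior {f : ℂ × ℂ → ℂ} {W : Set (ℂ × ℂ)}
    (hW : IsPreconnected W) (hf : MeromorphicOn₂ f W) {p : ℂ × ℂ} (hp : p ∈ W)
    (hfp : ContinuousAt f p) (hfp0 : f p ≠ 0) :
    ∀ x ∈ W, x ∉ closure (interior {y | f y = 0}) := by
  -- The closure of the interior of the zero set is shown to be relatively open as well as closed.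
  -- The closure is needed because the values of `f` where the local denominator vanishes are
  -- arbitrary.
  have hkey : closure (interior {y | f y = 0}) ∩ W ⊆
      interior (closure (interior {y | f y = 0})) := by
    rintro x ⟨hx, hxW⟩
    obtain ⟨r, hr, g, h, hg, hh, hne, hfgh⟩ := hf.exists_ball hxW
    have hpre : IsPreconnected (Metric.ball x r) := (convex_ball x r).isPreconnected
    have hdense : ∀ y ∈ Metric.ball x r, ∃ᶠ w in 𝓝 y, h w ≠ 0 := by
      intro y hy h0
      have h1 : ∀ᶠ w in 𝓝 y, h w = 0 := h0.mono fun w hw => not_not.1 hw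
      refine hne ?_
      filter_upwards [Metric.ball_mem_nhds x hr] with w hw
      exact hh.eqOn_zero_of_preconnected_of_eventuallyEq_zero hpre hy h1 hw
    have hg0 : Set.EqOn g 0 (Metric.ball x r) := by
      obtain ⟨y, hyb, hyO⟩ := mem_closure_iff_nhds.1 hx _ (Metric.ball_mem_nhds x hr)
      obtain ⟨w, hwh, hwb, hwO⟩ := ((hdense y hyb).and_eventually
        ((Metric.isOpen_ball.eventually_mem hyb).and (isOpen_interior.eventually_mem hyO))).exists
      refine hg.eqOn_zero_of_preconnected_of_eventuallyEq_zero hpre hwb ?_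
      filter_upwards [(hh w hwb).continuousAt.eventually_ne hwh,
        Metric.isOpen_ball.mem_nhds hwb, mem_interior_iff_mem_nhds.1 hwO] with v hv hvb hv0
      have := hfgh v hvb hv
      rw [show f v = 0 from hv0, eq_comm, div_eq_zero_iff] at this
      exact this.resolve_right hv
    refine mem_interior.2 ⟨_, fun y hy => ?_, Metric.isOpen_ball, Metric.mem_ball_self hr⟩
    rw [mem_closure_iff_frequently]
    refine ((hdense y hy).and_eventually (Metric.isOpen_ball.mem_nhds hy)).mono ?_
    rintro w ⟨hw, hwb⟩
    refine mem_interior_iff_mem_nhds.2 ?_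
    filter_upwards [(hh w hwb).continuousAt.eventually_ne hw, Metric.isOpen_ball.mem_nhds hwb]
      with v hv hvb
    have := hfgh v hvb hv
    rwa [hg0 hvb, Pi.zero_apply, zero_div] at this
  have hpn : p ∉ closure (interior {y | f y = 0}) := by
    intro h0
    obtain ⟨y, hy, hyO⟩ := mem_closure_iff_nhds.1 h0 _ (hfp.eventually_ne hfp0)
    exact hy (interior_subset (s := {y | f y = 0}) hyO)
  intro x hx hxc
  refine hpn (interior_subset (hW.subset_of_closure_inter_subset isOpen_interior
    ⟨x, hx, hkey ⟨hxc, hx⟩⟩ (fun y hy => hkey ⟨?_, hy.2⟩) hp))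
  exact closure_minimal interior_subset isClosed_closure hy.1

/-- In a local quotient `g / h` the numerator cannot vanish identically either, by the preceding
identity principle; hence for all but countably many `q` both have only isolated zeros on the slice.
-/
theorem MeromorphicOn₂.exists_countable_ne_zero {f : ℂ × ℂ → ℂ} {W : Set (ℂ × ℂ)}
    (hW : IsPreconnected W) (hf : MeromorphicOn₂ f W) {p : ℂ × ℂ} (hp : p ∈ W)
    (hfp : ContinuousAt f p) (hfp0 : f p ≠ 0) :
    ∃ S : Set ℂ, S.Countable ∧ ∀ x ∈ W, x.2 ∉ S → ∀ᶠ z in 𝓝[≠] x.1, f (z, x.2) ≠ 0 := by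
  refine exists_countable_of_locally fun x hx => ?_
  obtain ⟨r, hr, g, h, hg, hh, hne, hfgh⟩ := hf.exists_ball hx
  have hgne : ¬ ∀ᶠ y in 𝓝 x, g y = 0 := by
    intro h0
    refine hf.notMem_closure_interior hW hp hfp hfp0 x hx ?_
    rw [mem_closure_iff_frequently]
    refine ((not_eventually.1 hne).and_eventually (h0.eventually_nhds.and
      (Metric.ball_mem_nhds x hr))).mono ?_
    rintro w ⟨hw, hwg, hwb⟩
    refine mem_interior_iff_mem_nhds.2 ?_
    filter_upwards [(hh w hwb).continuousAt.eventually_ne hw, hwg,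
      Metric.isOpen_ball.mem_nhds hwb] with v hv hvg hvb
    have := hfgh v hvb hv
    rwa [hvg, zero_div] at this
  obtain ⟨S, hS, hSh⟩ := exists_countable_eventually_ne_zero_ball hr hh hne
  obtain ⟨S', hS', hSg⟩ := exists_countable_eventually_ne_zero_ball hr hg hgne
  refine ⟨_, Metric.ball_mem_nhds x hr, S ∪ S', hS.union hS', fun y hy hyS => ?_⟩
  filter_upwards [hSh y hy fun h0 => hyS (Or.inl h0), hSg y hy fun h0 => hyS (Or.inr h0),
    eventually_slice_mem (Metric.isOpen_ball.mem_nhds hy)] with z hzh hzg hzb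
  rw [hfgh _ hzb hzh]
  exact div_ne_zero hzg hzh

/-! ### Solutions that depend on `q` -/

theorem exists_countable_sections {U V : Set ℂ} (hUo : IsOpen U)
    {K : ℂ × ℂ → Matrix (Fin 3) (Fin 3) ℂ}
    (hK : ∀ i j, MeromorphicOn₂ (fun x => K x i j) (U ×ˢ V)) :
    ∃ S : Set ℂ, S.Countable ∧ ∀ q ∈ V \ S, (∀ i j, MeromorphicOn (fun z => K (z, q) i j) U) ∧
      ∀ᶠ z in codiscreteWithin U, EntriesAnalyticAt K (z, q) := by
  choose S hS hSK using fun i j => (hK i j).exists_countable_section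
  refine ⟨⋃ i, ⋃ j, S i j, Set.countable_iUnion fun i => Set.countable_iUnion fun j => hS i j,
    fun q hq => ?_⟩
  have hqS : ∀ i j, q ∉ S i j := fun i j h0 =>
    hq.2 (Set.mem_iUnion.2 ⟨i, Set.mem_iUnion.2 ⟨j, h0⟩⟩)
  refine ⟨fun i j z hz => (hSK i j (z, q) ⟨hz, hq.1⟩ (hqS i j)).1, ?_⟩
  refine (eventually_codiscreteWithin_iff_of_isOpen hUo).2 fun z hz => ?_
  exact eventually_all.2 fun i => eventually_all.2 fun j =>
    (hSK i j (z, q) ⟨hz, hq.1⟩ (hqS i j)).2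

theorem countable_not_admissible : {q : ℂ | ¬ Admissible q}.Countable := by
  refine Set.Countable.mono ?_ (Set.toFinite {0, 1, -1}).countable
  intro q hq
  by_cases h0 : q = 0
  · simp [h0]
  · have h1 : q ^ 2 = 1 := by_contra fun h1 => hq ⟨h0, h1⟩
    rcases mul_self_eq_one_iff.1 ((sq q).symm.trans h1) with h | h <;> simp [h]

/-- Three countable sets of `q` are discarded: those with a non-meromorphic slice or too few
analytic points, those where a chosen nonzero entry dies on the slice, and the inadmissible ones.
The fixed-`q` result applies to the rest. -/
theorem exists_countable_mem_upToFactor {U V : Set ℂ} (hUo : IsOpen U) (hUc : IsConnected U)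
    (hVc : IsConnected V) {K : ℂ × ℂ → Matrix (Fin 3) (Fin 3) ℂ} (hK : K ∈ solutionSpace₂ U V) :
    ∃ S : Set ℂ, S.Countable ∧ ∀ q ∈ V \ S, (fun z => K (z, q)) ∈ upToFactor U (AI ∪ AII) := by
  obtain ⟨hmer, ⟨p, hp, i, j, han, hne⟩, hRE⟩ := hK
  obtain ⟨S, hS, hSK⟩ := exists_countable_sections hUo hmer
  obtain ⟨S', hS', hSne⟩ := (hmer i j).exists_countable_ne_zero
    (hUc.isPreconnected.prod hVc.isPreconnected) hp han.continuousAt hne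
  refine ⟨S ∪ S' ∪ {q | ¬ Admissible q}, (hS.union hS').union countable_not_admissible,
    fun q hq => ?_⟩
  have hqS : q ∉ S := fun h => hq.2 (Or.inl (Or.inl h))
  have hqS' : q ∉ S' := fun h => hq.2 (Or.inl (Or.inr h))
  have hqa : Admissible q := by_contra fun h => hq.2 (Or.inr h)
  obtain ⟨h1, h2⟩ := hSK q ⟨hq.1, hqS⟩
  refine mem_upToFactor_of_reflectionEq hqa hUo hUc h1 ⟨i, j, fun h0 => ?_⟩
    ((eventually_mem_codiscreteWithin U).and h2)
    fun z hz w hw hreg => hRE z hz.1 w hw.1 q hq.1 hqa hreg hz.2 hw.2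
  obtain ⟨z, hz⟩ := hUc.nonempty
  obtain ⟨w, hw, hw'⟩ := (((eventually_codiscreteWithin_iff_of_isOpen hUo).1 h0 z hz).and
    (hSne (z, q) ⟨hz, hq.1⟩ hqS')).exists
  exact hw' hw

theorem neBot_nhdsWithin_compl_of_countable {S : Set ℂ} (hS : S.Countable) (q : ℂ) :
    (𝓝[Sᶜ] q).NeBot :=
  mem_closure_iff_nhdsWithin_neBot.1 (hS.dense_compl ℂ q)

theorem EntriesAnalyticAt.section_left {K : ℂ × ℂ → Matrix (Fin 3) (Fin 3) ℂ} {z q : ℂ}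
    (h : EntriesAnalyticAt K (z, q)) : EntriesAnalyticAt (fun z => K (z, q)) z := fun i j =>
  (h i j).comp₂ analyticAt_id analyticAt_const

theorem EntriesAnalyticAt.eventually {K : ℂ × ℂ → Matrix (Fin 3) (Fin 3) ℂ} {p : ℂ × ℂ}
    (h : EntriesAnalyticAt K p) : ∀ᶠ x in 𝓝 p, EntriesAnalyticAt K x :=
  eventually_all.2 fun i => eventually_all.2 fun j => (h i j).eventually_analyticAt

/-- Regularity of `(z₁, z₂)` does not involve `q`, and analyticity at `(z₁, q)` and `(z₂, q)`
persists for nearby parameters. An arbitrary admissible `q` is therefore a limit of good parameters,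
the complement of a countable set being dense, and the equation survives the limit. -/
theorem mem_solutionSpace₂ {U V : Set ℂ} (hUo : IsOpen U) (hUc : IsConnected U) (hVo : IsOpen V)
    (hVn : V.Nonempty) {K : ℂ × ℂ → Matrix (Fin 3) (Fin 3) ℂ}
    (hmer : ∀ i j, MeromorphicOn₂ (fun x => K x i j) (U ×ˢ V)) {S : Set ℂ} (hS : S.Countable)
    (hSK : ∀ q ∈ V \ S, (fun z => K (z, q)) ∈ upToFactor U (AI ∪ AII)) :
    K ∈ solutionSpace₂ U V := by
  refine ⟨hmer, ?_, ?_⟩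
  · obtain ⟨S', hS', hSan⟩ := exists_countable_sections hUo hmer
    obtain ⟨q₀, hq₀⟩ := hVn
    have := neBot_nhdsWithin_compl_of_countable
      ((hS.union hS').union countable_not_admissible) q₀
    obtain ⟨q, hqS, hqV⟩ := (eventually_mem_nhdsWithin.and
      (nhdsWithin_le_nhds (hVo.eventually_mem hq₀) : ∀ᶠ q in
        𝓝[(S ∪ S' ∪ {q | ¬ Admissible q})ᶜ] q₀, q ∈ V)).exists
    have hqa : Admissible q := by_contra fun h => hqS (Or.inr h)
    obtain ⟨i, j, hij⟩ := not_eventually_eq_zero_of_notIdenticallyZero hUo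
      (upToFactor_subset_solutionSpace hqa hUo hUc
        (hSK q ⟨hqV, fun h => hqS (Or.inl (Or.inl h))⟩)).2.1
    obtain ⟨z, hz, hza, hzU⟩ := ((not_eventually.1 hij).and_eventually
      ((hSan q ⟨hqV, fun h => hqS (Or.inl (Or.inr h))⟩).2.and
        (eventually_mem_codiscreteWithin U))).exists
    exact ⟨(z, q), ⟨hzU, hqV⟩, i, j, hza i j, hz⟩
  · intro z₁ hz₁ z₂ hz₂ q hqV hqa hreg h₁ h₂
    rw [reflectionEq_iff_num hqa hreg]
    have := neBot_nhdsWithin_compl_of_countable (hS.union countable_not_admissible) q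
    obtain ⟨l, hl⟩ : ∃ l, l = 𝓝[(S ∪ {q | ¬ Admissible q})ᶜ] q := ⟨_, rfl⟩
    rw [← hl] at this
    have hid : Tendsto (fun t : ℂ => t) l (𝓝 q) := by
      rw [hl]
      exact nhdsWithin_le_nhds
    have hmem : ∀ᶠ t in l, t ∈ (S ∪ {q | ¬ Admissible q})ᶜ := by
      rw [hl]
      exact self_mem_nhdsWithin
    have t₁ : Tendsto (fun t : ℂ => (z₁, t)) l (𝓝 (z₁, q)) := tendsto_const_nhds.prodMk_nhds hid
    have t₂ : Tendsto (fun t : ℂ => (z₂, t)) l (𝓝 (z₂, q)) := tendsto_const_nhds.prodMk_nhds hid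
    refine reflectionEqNum_of_tendsto
      (((hid.pow 2).sub tendsto_const_nhds).inv₀ (sub_ne_zero.2 hqa.2))
      tendsto_const_nhds tendsto_const_nhds (h₁.tendsto.comp t₁) (h₂.tendsto.comp t₂) ?_
    filter_upwards [hmem, hid.eventually (hVo.mem_nhds hqV), t₁.eventually h₁.eventually,
      t₂.eventually h₂.eventually] with t ht htV ht₁ ht₂
    have hta : Admissible t := by_contra fun h => ht (Or.inr h)
    exact (reflectionEq_iff_num hta hreg _ _).1 ((upToFactor_subset_solutionSpace hta hUo hUc
      (hSK t ⟨htV, fun h => ht (Or.inl h)⟩)).2.2 z₁ hz₁ z₂ hz₂ hreg ht₁.section_left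
        ht₂.section_left)

end CremmerGervais

theorem mainTheorem1 (U : Set ℂ) (hUo : IsOpen U) (hUc : IsConnected U) :
    (∀ q : ℂ, CremmerGervais.Admissible q →
      CremmerGervais.solutionSpace q U =
        CremmerGervais.upToFactor U (CremmerGervais.AI ∪ CremmerGervais.AII)) ∧
    (∀ q q' : ℂ, CremmerGervais.Admissible q → CremmerGervais.Admissible q' →
      CremmerGervais.solutionSpace q U = CremmerGervais.solutionSpace q' U) ∧
    (∀ V : Set ℂ, IsOpen V → IsConnected V →
      CremmerGervais.solutionSpace₂ U V =
        {K | (∀ i j, CremmerGervais.MeromorphicOn₂ (fun x => K x i j) (U ×ˢ V)) ∧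
          ∃ S : Set ℂ, S.Countable ∧ ∀ q ∈ V \ S,
            (fun z => K (z, q)) ∈
              CremmerGervais.upToFactor U (CremmerGervais.AI ∪ CremmerGervais.AII)}) := by
  refine ⟨fun q hq => CremmerGervais.solutionSpace_eq_upToFactor hq hUo hUc,
    fun q q' hq hq' => ?_, fun V hVo hVc => Set.Subset.antisymm (fun K hK => ?_) ?_⟩
  · rw [CremmerGervais.solutionSpace_eq_upToFactor hq hUo hUc,
      CremmerGervais.solutionSpace_eq_upToFactor hq' hUo hUc]
  · exact ⟨hK.1, CremmerGervais.exists_countable_mem_upToFactor hUo hUc hVc hK⟩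
  · rintro K ⟨hmer, S, hS, hSK⟩
    exact CremmerGervais.mem_solutionSpace₂ hUo hUc hVo hVc.nonempty hmer hS hSK
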